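/- Let $p\ge 2$ and $m\geq 1$ be integers and $r$ an integer with $r^p\equiv 1 \pmod m$. Let $G=\langle x,y \mid x^p=y^m=1,\ x^{-1}yx=y^r\rangle$ (so that $|G|=pm$), and suppose that $p$ is the smallest prime divisor of $|G|$ and $\gcd(p(r-1),m)=1$. A sequence over $G$ is a finite unordered sequence $S=g_1\cdot\ldots\cdot g_\ell$ of elements of $G$, repetition allowed, of length $|S|=\ell$; $g^{[k]}$ denotes the sequence consisting of $k$ copies of $g$. The sequence $S$ is product-one free if no nonempty subsequence of $S$ can be ordered so that the product of its terms is $1$, and $\mathsf d(G)$ is the maximal length of a product-one free sequence over $G$. Then $\mathsf d(G)=m+p-2$, and for every sequence $S$ over $G$ with $|S|=\mathsf d(G)=m+p-2$ the following statements are equivalent. (a) $S$ is product-one free. (b) $S$ is of one of the following forms: (i) if $G\not\cong C_2\ltimes C_3$ (the non-abelian group of order $6$), then $$S=(x^ay^{b_1})\cdot\ldots\cdot(x^ay^{b_{p-1}})\cdot(y^c)^{[m-1]}$$ for some integers $a\in[1,p-1]$, $b_1,\dots,b_{p-1}\in[0,m-1]$ and $c\in[0,m-1]$ with $\gcd(c,m)=1$;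 (ii) if $G\cong C_2\ltimes C_3$, then $S=x\cdot xy\cdot xy^2$, or $S=xy^b\cdot(y^c)^{[2]}$ for some $b\in[0,2]$ and $c\in[1,2]$. -/

import Mathlib

section SequencesOverGroups

variable {G : Type*} [Group G]

/-- `π(S)`: the products of the terms of the (unordered) sequence `S`, taken in all orders. -/
def productSet (S : Multiset G) : Set G :=
  {g | ∃ l : List G, (l : Multiset G) = S ∧ l.prod = g}

/-- `Π_n(S)`: the products of the subsequences of `S` of length `n`. -/
def nProductSet (n : ℕ) (S : Multiset G) : Set G :=
  {g | ∃ T : Multiset G, T ≤ S ∧ T.card = n ∧ g ∈ productSet T}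

/-- `Π(S)`: the products of all nonempty subsequences of `S`. -/
def subProductSet (S : Multiset G) : Set G :=
  {g | ∃ n : ℕ, 1 ≤ n ∧ n ≤ S.card ∧ g ∈ nProductSet n S}

/-- `S` is product-one free if `1 ∉ Π(S)`. -/
def ProductOneFree (S : Multiset G) : Prop :=
  (1 : G) ∉ subProductSet S

end SequencesOverGroups

/-- The small Davenport constant `d(G)`: the maximal length of a product-one free sequence
over the (finite) group `G`. -/
noncomputable def smallDavenport (G : Type*) [Group G] : ℕ :=
  sSup {l : ℕ | ∃ S : Multiset G, S.card = l ∧ ProductOneFree S}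

/-- The relators of `⟨x, y | x^p = y^m = 1, x⁻¹ y x = y^r⟩`,
where `x` is the generator `0` and `y` is the generator `1`. -/
def metacyclicRels (p m : ℕ) (r : ℤ) : Set (FreeGroup (Fin 2)) :=
  {FreeGroup.of 0 ^ p,
   FreeGroup.of 1 ^ m,
   (FreeGroup.of 0)⁻¹ * FreeGroup.of 1 * FreeGroup.of 0 * (FreeGroup.of 1 ^ r)⁻¹}

/-- The group `⟨x, y | x^p = y^m = 1, x⁻¹ y x = y^r⟩`. -/
abbrev MetacyclicGroup (p m : ℕ) (r : ℤ) : Type :=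
  PresentedGroup (metacyclicRels p m r)

namespace MetacyclicGroup

/-- The generator `x`. -/
def x (p m : ℕ) (r : ℤ) : MetacyclicGroup p m r :=
  PresentedGroup.of 0

/-- The generator `y`. -/
def y (p m : ℕ) (r : ℤ) : MetacyclicGroup p m r :=
  PresentedGroup.of 1

end MetacyclicGroup

/-- `G ≅ C₂ ⋉ C₃`: the group `G` is isomorphic to a semidirect product of `C₂` acting
nontrivially on the normal subgroup `C₃`. -/
def IsIsoC2C3 (G : Type*) [Group G] : Prop :=
  ∃ φ : Multiplicative (ZMod 2) →* MulAut (Multiplicative (ZMod 3)),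
    φ ≠ 1 ∧
      Nonempty (G ≃* SemidirectProduct (Multiplicative (ZMod 3)) (Multiplicative (ZMod 2)) φ)

/-! The presentation yields a Frobenius group C_p ⋉ C_m: every element is x^i y^j in exactly one
way, and a nontrivial class of C_p acts on the kernel C_m as multiplication by a unit ρ such that ρ
− 1 is also a unit, hence without nonzero fixed points. For a sequence S let K(S) ⊆ ℤ/m (`kerProds`)
consist of the kernel elements that are products of subsequences, the empty one included. If S + T
is product-one free, then 0 has only the trivial representation in K(S) + K(T), and Scherk's theorem
gives |K(S + T)| ≥ |K(S)| + |K(T)| − 1.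

Let W be a minimal nonempty block whose image in C_p has sum zero. The rotations of a product of W
are conjugates by pairwise different classes, so |K(W)| ≥ |W| + 1. Splitting S into such blocks and
a rest of at most p − 1 terms gives |S| + 2 ≤ |K(S)| + p ≤ m + p (`card_le_card_kerProds_add`),
which is the upper bound for d(G).

If |S| = m + p − 2, equality holds throughout and survives the removal of blocks (`Tight.of_add`).
The rest must then be p − 1 terms of one class g determined by S, whence every term of S has class 0
or g, and the number of terms of class g is −1 modulo p (`Tight.e_mem`). If this number is p − 1,
the other m − 1 terms form a longest zero-sum free sequence over C_m, which is constant.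

Otherwise there is a subsequence T of 2p − 1 terms of class g, and |K(T)| ≤ p + 1. For odd p this is
impossible (`lt_card_kerProds_of_odd`): K(T) without 0 would be an arithmetic progression of p terms
stable under multiplication by ρ(g), so its sum, and with it its middle term, would be 0. For p = 2
the set K(T) is a subgroup {0, d, −d} of order 3 and leaves no room for further terms
(`eq_of_three_le`); this is the exceptional sequence over the group of order 6. -/

open scoped Pointwise

/-! ### Scherk's theorem and zero-sum free sequences over cyclic groups -/

section Additive

/-- Scherk's theorem: if `0 = a + b` has only the trivial representation in `A + B`, then
`A + B` has at least `#A + #B - 1` elements. -/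
theorem card_add_card_le_card_add_of_unique_zero {α : Type*} [AddCommGroup α] [DecidableEq α]
    (A B : Finset α) (hA : (0 : α) ∈ A) (hB : (0 : α) ∈ B)
    (h : ∀ a ∈ A, ∀ b ∈ B, a + b = 0 → b = 0) :
    A.card + B.card ≤ (A + B).card + 1 := by
  induction hn : B.card using Nat.strong_induction_on generalizing A B with
  | _ n ih =>
  subst hn
  -- If A + B ⊆ A, then all multiples of b ∈ B lie in A, among them −b, so B = {0}.
  by_cases hcl : ∀ e ∈ A, ∀ b ∈ B, e + b ∈ A
  · have hB1 : B ⊆ {0} := by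
      intro b hb
      have hmul : ∀ k : ℕ, k • b ∈ A := by
        intro k
        induction k with
        | zero => simpa using hA
        | succ k ihk => rw [succ_nsmul]; exact hcl _ ihk _ hb
      have hfin : ¬ Function.Injective (fun k : ℕ => (⟨k • b, hmul k⟩ : A)) :=
        not_injective_infinite_finite _
      rw [Function.Injective] at hfin
      push Not at hfin
      obtain ⟨i, j, hij, hne⟩ := hfin
      have hij' : i • b = j • b := congrArg Subtype.val hij
      obtain ⟨k, hk⟩ : ∃ k : ℕ, k • b + b = 0 := by
        rcases lt_or_gt_of_ne hne with hlt | hlt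
        · obtain ⟨k, rfl⟩ := Nat.exists_eq_add_of_lt hlt
          refine ⟨k, ?_⟩
          rw [add_assoc, add_nsmul, succ_nsmul] at hij'
          simpa using hij'.symm
        · obtain ⟨k, rfl⟩ := Nat.exists_eq_add_of_lt hlt
          refine ⟨k, ?_⟩
          rw [add_assoc, add_nsmul, succ_nsmul] at hij'
          simpa using hij'
      simpa using h _ (hmul k) _ hb hk
    have h1 : B.card ≤ 1 := by simpa using Finset.card_le_card hB1
    have h2 : A.card ≤ (A + B).card := by
      apply Finset.card_le_card
      intro a ha
      simpa using Finset.add_mem_add ha hB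
    omega
  · push Not at hcl
    obtain ⟨e, he, b₀, hb₀, hnot⟩ := hcl
    -- Dyson's e-transform: it keeps |A| + |B|, does not enlarge the sumset, and removes b₀ from B.
    set A' := A ∪ B.image (e + ·) with hA'
    set B' := B.filter (fun b => e + b ∈ A) with hB'
    have hlt : B'.card < B.card := by
      apply Finset.card_lt_card
      refine ⟨Finset.filter_subset _ _, fun hs => hnot ?_⟩
      exact (Finset.mem_filter.1 (hs hb₀)).2
    have key := ih _ hlt A' B' (Finset.mem_union_left _ hA)
      (Finset.mem_filter.2 ⟨hB, by simpa using he⟩) (by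
        intro a ha b hb hab
        obtain ⟨hbB, hbA⟩ := Finset.mem_filter.1 hb
        rcases Finset.mem_union.1 ha with ha | ha
        · exact h a ha b hbB hab
        · obtain ⟨c, hc, rfl⟩ := Finset.mem_image.1 ha
          have h1 : c = 0 := h (e + b) hbA c hc (by rw [← hab]; abel)
          subst h1
          exact h e he b hbB (by simpa using hab)) rfl
    have hsub : A' + B' ⊆ A + B := by
      intro z hz
      obtain ⟨a, ha, b, hb, rfl⟩ := Finset.mem_add.1 hz
      obtain ⟨hbB, hbA⟩ := Finset.mem_filter.1 hb
      rcases Finset.mem_union.1 ha with ha | ha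
      · exact Finset.add_mem_add ha hbB
      · obtain ⟨c, hc, rfl⟩ := Finset.mem_image.1 ha
        rw [show e + c + b = (e + b) + c by abel]
        exact Finset.add_mem_add hbA hc
    have hcard : A'.card + B'.card = A.card + B.card := by
      have h1 : (A ∩ B.image (e + ·)).card = B'.card := by
        have : A ∩ B.image (e + ·) = B'.image (e + ·) := by
          ext z
          simp only [Finset.mem_inter, Finset.mem_image, hB', Finset.mem_filter]
          constructor
          · rintro ⟨hz, c, hc, rfl⟩
            exact ⟨c, ⟨hc, hz⟩, rfl⟩
          · rintro ⟨c, ⟨hc, hz⟩, rfl⟩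
            exact ⟨hz, c, hc, rfl⟩
        rw [this, Finset.card_image_of_injective _ (add_right_injective e)]
      have h2 := Finset.card_union_add_card_inter A (B.image (e + ·))
      rw [h1, Finset.card_image_of_injective _ (add_right_injective e)] at h2
      exact h2
    have := Finset.card_le_card hsub
    omega

/-- A sequence over an additive commutative group is zero-sum free if no nonempty
subsequence has sum `0`. -/
def ZeroSumFree {α : Type*} [AddCommMonoid α] (s : Multiset α) : Prop :=
  ∀ t ≤ s, t.sum = 0 → t = 0

/-- The set of all subsequence sums, including the empty one. -/
def subsums {α : Type*} [AddCommMonoid α] [DecidableEq α] (s : Multiset α) : Finset α :=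
  (s.powerset.map Multiset.sum).toFinset

theorem mem_subsums {α : Type*} [AddCommMonoid α] [DecidableEq α] {s : Multiset α} {a : α} :
    a ∈ subsums s ↔ ∃ t ≤ s, t.sum = a := by
  simp [subsums]

theorem ZeroSumFree.mono {α : Type*} [AddCommMonoid α] {s t : Multiset α}
    (h : ZeroSumFree s) (hts : t ≤ s) : ZeroSumFree t :=
  fun u hu hu0 => h u (hu.trans hts) hu0

theorem card_subsums_add_card_subsums_le {α : Type*} [AddCommGroup α] [DecidableEq α]
    {s t : Multiset α} (h : ZeroSumFree (s + t)) :
    (subsums s).card + (subsums t).card ≤ (subsums (s + t)).card + 1 := by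
  refine (card_add_card_le_card_add_of_unique_zero _ _ (mem_subsums.2 ⟨0, by simp, by simp⟩)
    (mem_subsums.2 ⟨0, by simp, by simp⟩) ?_).trans
    (Nat.add_le_add_right (Finset.card_le_card ?_) 1)
  · intro a ha b hb hab
    obtain ⟨u, hu, rfl⟩ := mem_subsums.1 ha
    obtain ⟨v, hv, rfl⟩ := mem_subsums.1 hb
    have := h (u + v) (add_le_add hu hv) (by simpa using hab)
    have hv0 : v = 0 := by
      have := congrArg Multiset.card this
      rw [Multiset.card_add, Multiset.card_zero] at this
      exact Multiset.card_eq_zero.1 (by omega)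
    simp [hv0]
  · intro z hz
    obtain ⟨a, ha, b, hb, rfl⟩ := Finset.mem_add.1 hz
    obtain ⟨u, hu, rfl⟩ := mem_subsums.1 ha
    obtain ⟨v, hv, rfl⟩ := mem_subsums.1 hb
    exact mem_subsums.2 ⟨u + v, add_le_add hu hv, by simp⟩

theorem ZeroSumFree.card_lt_card_subsums {α : Type*} [AddCommGroup α] [DecidableEq α]
    {s : Multiset α} (h : ZeroSumFree s) : s.card + 1 ≤ (subsums s).card := by
  induction s using Multiset.induction_on with
  | empty =>
    exact Finset.card_pos.2 ⟨0, mem_subsums.2 ⟨0, by simp, by simp⟩⟩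
  | cons a s ih =>
    have h1 := ih (h.mono (Multiset.le_cons_self s a))
    have h2 := card_subsums_add_card_subsums_le (s := {a}) (t := s) (by simpa using h)
    have ha : a ≠ 0 := by
      rintro rfl
      have := h {0} (by simp) (by simp)
      simp at this
    have h3 : ({0, a} : Finset α) ⊆ subsums {a} := by
      intro z hz
      simp only [Finset.mem_insert, Finset.mem_singleton] at hz
      rcases hz with rfl | rfl
      · exact mem_subsums.2 ⟨0, by simp, by simp⟩
      · exact mem_subsums.2 ⟨{z}, by simp, by simp⟩
    have h4 := Finset.card_le_card h3
    rw [Finset.card_pair ha.symm] at h4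
    rw [Multiset.singleton_add] at h2
    rw [Multiset.card_cons]
    omega

theorem ZeroSumFree.card_lt {n : ℕ} [NeZero n] {s : Multiset (ZMod n)} (h : ZeroSumFree s) :
    s.card < n := by
  have h1 := h.card_lt_card_subsums
  have h2 := Finset.card_le_univ (subsums s)
  rw [ZMod.card] at h2
  omega

/-- A zero-sum free sequence of maximal length over a cyclic group is constant. -/
theorem ZeroSumFree.eq_replicate {n : ℕ} [NeZero n] {s : Multiset (ZMod n)} (h : ZeroSumFree s)
    (hs : n ≤ s.card + 1) : ∃ c : ZMod n, IsUnit c ∧ s = Multiset.replicate (n - 1) c := by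
  have hlt := h.card_lt
  have hcard : s.card = n - 1 := by omega
  rcases Multiset.empty_or_exists_mem s with rfl | ⟨c, hc⟩
  · have hn : n = 1 := by
      have := NeZero.ne n
      simp at hcard
      omega
    subst hn
    exact ⟨0, by rw [Subsingleton.elim (0 : ZMod 1) 1]; exact isUnit_one, by simp⟩
  have hall : ∀ d ∈ s, d = c := by
    intro d hd
    by_contra hne
    obtain ⟨t, rfl⟩ := Multiset.exists_cons_of_mem hc
    have hd' : d ∈ t := by
      rcases Multiset.mem_cons.1 hd with h | h
      · exact absurd h hne
      · exact h
    obtain ⟨u, rfl⟩ := Multiset.exists_cons_of_mem hd'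
    have heq : c ::ₘ d ::ₘ u = ({c, d} : Multiset (ZMod n)) + u := by
      simp [Multiset.insert_eq_cons, Multiset.cons_add]
    rw [heq] at h hcard
    have h1 := card_subsums_add_card_subsums_le h
    have h2 := (h.mono (Multiset.le_add_left u _)).card_lt_card_subsums
    have h3 := Finset.card_le_univ (subsums ({c, d} + u))
    rw [ZMod.card] at h3
    have hcd := h.mono (Multiset.le_add_right _ u)
    have hc0 : c ≠ 0 := by
      rintro rfl
      have := hcd {0} (by simp) (by simp)
      simp at this
    have hd0 : d ≠ 0 := by
      rintro rfl
      have := hcd {0} (by simp [Multiset.insert_eq_cons]) (by simp)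
      simp at this
    have hcd0 : c + d ≠ 0 := by
      intro h0
      have := hcd {c, d} le_rfl (by simpa [Multiset.insert_eq_cons] using h0)
      simp at this
    -- Two different terms have four subsums, one more than the general bound guarantees. Together
    -- with the rest this would give more than n subsums in ℤ/n.
    have h4 : ({0, c, d, c + d} : Finset (ZMod n)) ⊆ subsums {c, d} := by
      intro z hz
      simp only [Finset.mem_insert, Finset.mem_singleton] at hz
      rcases hz with rfl | rfl | rfl | rfl
      · exact mem_subsums.2 ⟨0, by simp, by simp⟩
      · exact mem_subsums.2 ⟨{z}, by simp, by simp⟩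
      · exact mem_subsums.2 ⟨{z}, by simp [Multiset.insert_eq_cons], by simp⟩
      · exact mem_subsums.2 ⟨{c, d}, le_rfl, by simp [Multiset.insert_eq_cons]⟩
    have h5 : ({0, c, d, c + d} : Finset (ZMod n)).card = 4 := by
      rw [Finset.card_insert_of_notMem, Finset.card_insert_of_notMem,
        Finset.card_insert_of_notMem, Finset.card_singleton]
      · simpa using hc0
      · simp only [Finset.mem_insert, Finset.mem_singleton, not_or]
        exact ⟨Ne.symm hne, by simpa using hd0⟩
      · simp only [Finset.mem_insert, Finset.mem_singleton, not_or]
        exact ⟨hc0.symm, hd0.symm, hcd0.symm⟩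
    have h6 := Finset.card_le_card h4
    rw [Multiset.card_add] at hcard
    simp only [Multiset.insert_eq_cons, Multiset.card_cons, Multiset.card_singleton] at hcard h6 h1 h3
    rw [h5] at h6
    omega
  have hrep : s = Multiset.replicate (n - 1) c := Multiset.eq_replicate.2 ⟨hcard, hall⟩
  refine ⟨c, ?_, hrep⟩
  -- If g = gcd(c, n) exceeded 1, then n / g ≤ n − 1 copies of c would have sum zero.
  have hg : Nat.gcd c.val n = 1 := by
    by_contra hg
    set g := Nat.gcd c.val n with hgdef
    have hgn : g ∣ n := Nat.gcd_dvd_right _ _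
    have hgc : g ∣ c.val := Nat.gcd_dvd_left _ _
    have hnpos : 0 < n := Nat.pos_of_ne_zero (NeZero.ne n)
    have hgpos : 0 < g := Nat.pos_of_dvd_of_pos hgn hnpos
    have hk1 : n / g < n := Nat.div_lt_self hnpos (by omega)
    have hk0 : 0 < n / g := Nat.div_pos (Nat.le_of_dvd hnpos hgn) hgpos
    have := h (Multiset.replicate (n / g) c)
      (by rw [hrep]; exact (Multiset.replicate_le_replicate c).2 (by omega)) (by
        rw [Multiset.sum_replicate, nsmul_eq_mul]
        have : (c : ZMod n) = ((c.val : ℕ) : ZMod n) := by simp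
        rw [this, ← Nat.cast_mul, ZMod.natCast_eq_zero_iff]
        obtain ⟨w, hw⟩ := hgc
        rw [hw]
        refine ⟨w, ?_⟩
        rw [← mul_assoc, Nat.div_mul_cancel hgn])
    have := congrArg Multiset.card this
    rw [Multiset.card_replicate, Multiset.card_zero] at this
    omega
  have := (ZMod.isUnit_iff_coprime c.val n).2 hg
  simpa using this

end Additive

/-! ### Coordinates, products in the kernel, and the upper bound -/

theorem productOneFree_iff {G : Type*} [Group G] {S : Multiset G} :
    ProductOneFree S ↔ ∀ l : List G, (l : Multiset G) ≤ S → l.prod = 1 → l = [] := by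
  constructor
  · intro h l hl h1
    by_contra hne
    exact h ⟨l.length, List.length_pos_iff.2 hne, by simpa using Multiset.card_le_card hl,
      l, hl, by simp, l, rfl, h1⟩
  · rintro h ⟨n, hn, -, T, hT, hcard, l, rfl, h1⟩
    have := h l hT h1
    subst this
    simp at hcard
    omega

theorem Multiset.exists_le_map_eq {α β : Type*} {f : α → β} {s : Multiset α} {t : Multiset β}
    (h : t ≤ s.map f) : ∃ u ≤ s, u.map f = t := by
  induction s using Quotient.inductionOn with
  | _ l =>
  induction t using Quotient.inductionOn with
  | _ k =>
  obtain ⟨k', hk', hsub⟩ := h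
  obtain ⟨l', hl', rfl⟩ := List.sublist_map_iff.1 hsub
  exact ⟨l', Multiset.coe_le.2 hl'.subperm, Quotient.sound hk'⟩

/-- Coordinates `(e g, b g) ∈ ℤ/p × ℤ/m` on a group `G`, identifying it with the Frobenius group
`C_p ⋉ C_m` in which `e` acts on `C_m` by multiplication by `ρ e`. -/
structure FrobeniusCoord (G : Type*) [Group G] (p m : ℕ) where
  /-- the coordinate in the quotient `C_p` -/
  e : G → ZMod p
  /-- the coordinate in the kernel `C_m` -/
  b : G → ZMod m
  /-- the action -/
  ρ : ZMod p → ZMod m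
  e_mul : ∀ g h, e (g * h) = e g + e h
  b_mul : ∀ g h, b (g * h) = b g * ρ (e h) + b h
  ρ_zero : ρ 0 = 1
  ρ_add : ∀ i j, ρ (i + j) = ρ i * ρ j
  isUnit_ρ_sub_one : ∀ i, i ≠ 0 → IsUnit (ρ i - 1)
  ext : ∀ g h, e g = e h → b g = b h → g = h
  exists_coord : ∀ i j, ∃ g, e g = i ∧ b g = j

namespace FrobeniusCoord

variable {G : Type*} [Group G] {p m : ℕ} (c : FrobeniusCoord G p m)

theorem e_one : c.e 1 = 0 := by
  have := c.e_mul 1 1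
  simpa using this

theorem b_one : c.b 1 = 0 := by
  have := c.b_mul 1 1
  rw [mul_one, c.e_one, c.ρ_zero, mul_one] at this
  simpa using this

theorem eq_one_iff {g : G} : g = 1 ↔ c.e g = 0 ∧ c.b g = 0 := by
  constructor
  · rintro rfl
    exact ⟨c.e_one, c.b_one⟩
  · rintro ⟨h1, h2⟩
    exact c.ext _ _ (h1.trans c.e_one.symm) (h2.trans c.b_one.symm)

theorem e_prod (l : List G) : c.e l.prod = (l.map c.e).sum := by
  induction l with
  | nil => simpa using c.e_one
  | cons a l ih => simp [c.e_mul, ih]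

theorem e_prod_eq (l : List G) : c.e l.prod = ((l : Multiset G).map c.e).sum := by
  rw [c.e_prod]
  simp

theorem b_mul_of_e_eq_zero {g h : G} (hh : c.e h = 0) : c.b (g * h) = c.b g + c.b h := by
  rw [c.b_mul, hh, c.ρ_zero, mul_one]

theorem b_prod_of_e_eq_zero (l : List G) (hl : ∀ g ∈ l, c.e g = 0) :
    c.b l.prod = (l.map c.b).sum := by
  induction l with
  | nil => simpa using c.b_one
  | cons a l ih =>
    have hl' : ∀ g ∈ l, c.e g = 0 := fun g hg => hl g (by simp [hg])
    have h0 : c.e l.prod = 0 := by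
      rw [c.e_prod]
      exact List.sum_eq_zero (by simpa using hl')
    rw [List.prod_cons, c.b_mul_of_e_eq_zero h0, ih hl', List.map_cons, List.sum_cons]

theorem isUnit_ρ (i : ZMod p) : IsUnit (c.ρ i) := by
  refine IsUnit.of_mul_eq_one (c.ρ (-i)) ?_
  rw [← c.ρ_add, add_neg_cancel, c.ρ_zero]

/-- Conjugation by `g` acts on the kernel as multiplication by `ρ (e g)`. -/
theorem b_mul_comm {g h : G} (h0 : c.e (g * h) = 0) : c.b (h * g) = c.ρ (c.e g) * c.b (g * h) := by
  have h1 : c.ρ (c.e h) * c.ρ (c.e g) = 1 := by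
    rw [← c.ρ_add, add_comm, ← c.e_mul, h0, c.ρ_zero]
  rw [c.b_mul, c.b_mul]
  linear_combination -c.b g * h1

/-- The action of C_p is fixed-point free, so a nonzero kernel element has p different conjugates.
-/
theorem eq_zero_of_ρ_mul_eq {i j : ZMod p} (hij : i ≠ j) {z : ZMod m}
    (h : c.ρ i * z = c.ρ j * z) : z = 0 := by
  have h1 : c.ρ i = c.ρ j * c.ρ (i - j) := by rw [← c.ρ_add]; congr 1; ring
  have h2 : c.ρ j * (c.ρ (i - j) - 1) * z = 0 := by
    rw [h1] at h
    linear_combination h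
  have hu : IsUnit (c.ρ j * (c.ρ (i - j) - 1)) :=
    (c.isUnit_ρ j).mul (c.isUnit_ρ_sub_one _ (sub_ne_zero.2 hij))
  exact (hu.mul_right_eq_zero).1 h2

variable [NeZero m]

open Classical in
/-- The elements of the kernel that are products of (possibly empty) subsequences of `S`. -/
noncomputable def kerProds (S : Multiset G) : Finset (ZMod m) :=
  Finset.univ.filter fun z => ∃ l : List G, (l : Multiset G) ≤ S ∧ c.e l.prod = 0 ∧ c.b l.prod = z

theorem mem_kerProds {S : Multiset G} {z : ZMod m} :
    z ∈ c.kerProds S ↔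
      ∃ l : List G, (l : Multiset G) ≤ S ∧ c.e l.prod = 0 ∧ c.b l.prod = z := by
  simp [kerProds]

theorem zero_mem_kerProds (S : Multiset G) : (0 : ZMod m) ∈ c.kerProds S :=
  c.mem_kerProds.2 ⟨[], by simp, by simpa using c.e_one, by simpa using c.b_one⟩

theorem kerProds_mono {S T : Multiset G} (h : S ≤ T) : c.kerProds S ⊆ c.kerProds T := by
  intro z hz
  obtain ⟨l, hl, h1, h2⟩ := c.mem_kerProds.1 hz
  exact c.mem_kerProds.2 ⟨l, hl.trans h, h1, h2⟩

theorem add_mem_kerProds {S T : Multiset G} {z w : ZMod m} (hz : z ∈ c.kerProds S)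
    (hw : w ∈ c.kerProds T) : z + w ∈ c.kerProds (S + T) := by
  obtain ⟨l, hl, h1, rfl⟩ := c.mem_kerProds.1 hz
  obtain ⟨k, hk, h3, rfl⟩ := c.mem_kerProds.1 hw
  refine c.mem_kerProds.2 ⟨l ++ k, ?_, ?_, ?_⟩
  · rw [← Multiset.coe_add]
    exact add_le_add hl hk
  · rw [List.prod_append, c.e_mul, h1, h3, add_zero]
  · rw [List.prod_append, c.b_mul_of_e_eq_zero h3]

/-- Concatenating the two products would give a product-one subsequence. This is the hypothesis that
Scherk's theorem needs. -/
theorem eq_zero_of_add_eq_zero {S T : Multiset G} (hf : ProductOneFree (S + T)) {z w : ZMod m}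
    (hz : z ∈ c.kerProds S) (hw : w ∈ c.kerProds T) (h : z + w = 0) : w = 0 := by
  obtain ⟨l, hl, h1, rfl⟩ := c.mem_kerProds.1 hz
  obtain ⟨k, hk, h3, rfl⟩ := c.mem_kerProds.1 hw
  have := productOneFree_iff.1 hf (l ++ k) (by rw [← Multiset.coe_add]; exact add_le_add hl hk) (by
    rw [c.eq_one_iff, List.prod_append, c.e_mul, c.b_mul_of_e_eq_zero h3, h1, h3]
    exact ⟨add_zero _, h⟩)
  rw [List.append_eq_nil_iff] at this
  rw [this.2]
  simpa using c.b_one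

theorem card_kerProds_add_le {S T : Multiset G} (hf : ProductOneFree (S + T)) :
    (c.kerProds S).card + (c.kerProds T).card ≤ (c.kerProds (S + T)).card + 1 := by
  refine (card_add_card_le_card_add_of_unique_zero _ _ (c.zero_mem_kerProds S)
    (c.zero_mem_kerProds T) fun a ha b hb => c.eq_zero_of_add_eq_zero hf ha hb).trans
    (Nat.add_le_add_right (Finset.card_le_card ?_) 1)
  intro z hz
  obtain ⟨a, ha, b, hb, rfl⟩ := Finset.mem_add.1 hz
  exact c.add_mem_kerProds ha hb

theorem card_kerProds_le (S : Multiset G) : (c.kerProds S).card ≤ m := by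
  have := Finset.card_le_univ (c.kerProds S)
  rwa [ZMod.card] at this

omit [NeZero m] in
theorem _root_.ProductOneFree.mono {S T : Multiset G} (h : ProductOneFree T) (hST : S ≤ T) :
    ProductOneFree S :=
  productOneFree_iff.2 fun l hl => productOneFree_iff.1 h l (hl.trans hST)

/-- The exponent sum of a sequence, i.e. its image in the quotient `C_p`. -/
def expSum (S : Multiset G) : ZMod p := (S.map c.e).sum

omit [NeZero m] in
theorem expSum_add (S T : Multiset G) : c.expSum (S + T) = c.expSum S + c.expSum T := by
  simp [expSum]

omit [NeZero m] in
theorem e_prod_coe (l : List G) : c.e l.prod = c.expSum (l : Multiset G) := c.e_prod_eq l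

/-- Rotating an ordering of `W` conjugates its product by a prefix. No two prefixes share a class in
C_p, since the block between them would contradict minimality; so the rotations give `W.card`
different nonzero elements of the kernel. -/
theorem card_lt_card_kerProds_of_minimal {W : Multiset G} (hf : ProductOneFree W)
    (h0 : c.expSum W = 0) (hmin : ∀ V ≤ W, V ≠ 0 → c.expSum V = 0 → V = W) (hW : W ≠ 0) :
    W.card + 1 ≤ (c.kerProds W).card := by
  obtain ⟨l, rfl⟩ := Quot.exists_rep W
  change (l : Multiset G) ≠ 0 at hW
  change c.expSum (l : Multiset G) = 0 at h0
  change ProductOneFree (l : Multiset G) at hf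
  change ∀ V ≤ (l : Multiset G), V ≠ 0 → c.expSum V = 0 → V = (l : Multiset G) at hmin
  change (l : Multiset G).card + 1 ≤ (c.kerProds (l : Multiset G)).card
  have he : c.e l.prod = 0 := by rw [c.e_prod_coe, h0]
  have hb : c.b l.prod ≠ 0 := by
    intro hb
    exact hW (by simpa using productOneFree_iff.1 hf l le_rfl (c.eq_one_iff.2 ⟨he, hb⟩))
  set F : ℕ → ZMod m := fun i => c.ρ (c.e (l.take i).prod) * c.b l.prod with hF
  have hpre : ∀ i j, i < j → j < l.length → c.e (l.take i).prod ≠ c.e (l.take j).prod := by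
    intro i j hij hj heq
    have hsplit : l.take j = l.take i ++ (l.drop i).take (j - i) := by
      rw [← List.take_add]
      congr 1
      omega
    have hs : c.e ((l.drop i).take (j - i)).prod = 0 := by
      rw [hsplit, List.prod_append, c.e_mul] at heq
      simpa using heq
    have hlen : ((l.drop i).take (j - i)).length = j - i := by
      simp
      omega
    have hle : (((l.drop i).take (j - i) : List G) : Multiset G) ≤ l :=
      Multiset.coe_le.2 ((List.take_sublist _ _).trans (List.drop_sublist _ _)).subperm
    have := hmin _ hle (by
      intro h
      have := congrArg Multiset.card h
      rw [Multiset.coe_card, hlen, Multiset.card_zero] at this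
      omega) (by rw [← c.e_prod_coe]; exact hs)
    have := congrArg Multiset.card this
    rw [Multiset.coe_card, hlen, Multiset.coe_card] at this
    omega
  have hinj : Set.InjOn F (Finset.range l.length : Set ℕ) := by
    intro i hi j hj hij
    simp only [Finset.coe_range, Set.mem_Iio] at hi hj
    by_contra hne
    rcases lt_or_gt_of_ne hne with h | h
    · exact hb (c.eq_zero_of_ρ_mul_eq (hpre i j h hj) hij)
    · exact hb (c.eq_zero_of_ρ_mul_eq (hpre j i h hi) hij.symm)
  have hsub : insert 0 ((Finset.range l.length).image F) ⊆ c.kerProds (l : Multiset G) := by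
    intro z hz
    rcases Finset.mem_insert.1 hz with rfl | hz
    · exact c.zero_mem_kerProds _
    · obtain ⟨i, -, rfl⟩ := Finset.mem_image.1 hz
      have hl : (l.take i).prod * (l.drop i).prod = l.prod := by
        rw [← List.prod_append, List.take_append_drop]
      refine c.mem_kerProds.2 ⟨l.drop i ++ l.take i, ?_, ?_, ?_⟩
      · rw [← Multiset.coe_add, add_comm, Multiset.coe_add, List.take_append_drop]
      · rw [List.prod_append, c.e_mul, add_comm, ← c.e_mul, hl, he]
      · rw [List.prod_append, c.b_mul_comm (by rw [hl, he]), hl]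
  have hcard := Finset.card_le_card hsub
  rw [Finset.card_insert_of_notMem, Finset.card_image_of_injOn hinj, Finset.card_range] at hcard
  · simpa using hcard
  · intro h
    obtain ⟨i, -, hi⟩ := Finset.mem_image.1 h
    exact hb (((c.isUnit_ρ _).mul_right_eq_zero).1 hi)

omit [NeZero m] in
theorem exists_minimal_expSum_eq_zero {V : Multiset G} (hV : V ≠ 0) (h0 : c.expSum V = 0) :
    ∃ W ≤ V, W ≠ 0 ∧ c.expSum W = 0 ∧ ∀ X ≤ W, X ≠ 0 → c.expSum X = 0 → X = W := by
  induction hn : V.card using Nat.strong_induction_on generalizing V with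
  | _ n ih =>
  by_cases h : ∀ X ≤ V, X ≠ 0 → c.expSum X = 0 → X = V
  · exact ⟨V, le_rfl, hV, h0, h⟩
  · push Not at h
    obtain ⟨X, hX, hX0, hXs, hne⟩ := h
    have hlt : X.card < n := hn ▸ Multiset.card_lt_card (lt_of_le_of_ne hX hne)
    obtain ⟨W, hW, h'⟩ := ih _ hlt hX0 hXs rfl
    exact ⟨W, hW.trans hX, h'⟩

/-- `V` decomposes into minimal blocks, whose contributions add up by Scherk's theorem. -/
theorem card_lt_card_kerProds {V : Multiset G} (hf : ProductOneFree V) (h0 : c.expSum V = 0) :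
    V.card + 1 ≤ (c.kerProds V).card := by
  induction hn : V.card using Nat.strong_induction_on generalizing V with
  | _ n ih =>
  subst hn
  by_cases hV : V = 0
  · subst hV
    simpa using ⟨0, c.zero_mem_kerProds 0⟩
  obtain ⟨W, hW, hW0, hWs, hmin⟩ := c.exists_minimal_expSum_eq_zero hV h0
  obtain ⟨X, rfl⟩ := Multiset.le_iff_exists_add.1 hW
  have hWpos : 0 < W.card := Multiset.card_pos.2 hW0
  have h1 := c.card_lt_card_kerProds_of_minimal (hf.mono hW) hWs hmin hW0
  have h2 := ih X.card (by rw [Multiset.card_add]; omega)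
    (hf.mono (Multiset.le_add_left X W))
    (by rw [c.expSum_add, hWs, zero_add] at h0; exact h0) rfl
  have h3 := c.card_kerProds_add_le hf
  rw [Multiset.card_add]
  omega

omit [NeZero m] in
/-- Every sequence is the sum of one of exponent sum zero and one whose image in `C_p` is
zero-sum free. -/
theorem exists_add_zeroSumFree (S : Multiset G) :
    ∃ V R, S = V + R ∧ c.expSum V = 0 ∧ ZeroSumFree (R.map c.e) := by
  induction hn : S.card using Nat.strong_induction_on generalizing S with
  | _ n ih =>
  subst hn
  by_cases h : ∀ X ≤ S, c.expSum X = 0 → X = 0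
  · refine ⟨0, S, by simp, by simp [expSum], fun t ht ht0 => ?_⟩
    obtain ⟨X, hX, rfl⟩ : ∃ X ≤ S, X.map c.e = t := Multiset.exists_le_map_eq ht
    rw [h X hX ht0, Multiset.map_zero]
  · push Not at h
    obtain ⟨X, hX, hXs, hX0⟩ := h
    obtain ⟨Y, rfl⟩ := Multiset.le_iff_exists_add.1 hX
    have := Multiset.card_pos.2 hX0
    obtain ⟨V, R, rfl, hV, hR⟩ := ih Y.card (by rw [Multiset.card_add]; omega) Y rfl
    exact ⟨X + V, R, (add_assoc _ _ _).symm, by rw [c.expSum_add, hXs, hV, add_zero], hR⟩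

/-- Outside a part of exponent sum zero there are at most p − 1 terms, by the Davenport constant of
C_p. -/
theorem card_le_card_kerProds_add [NeZero p] {S : Multiset G} (hf : ProductOneFree S) :
    S.card + 2 ≤ (c.kerProds S).card + p := by
  obtain ⟨V, R, rfl, hV, hR⟩ := c.exists_add_zeroSumFree S
  have h1 := c.card_lt_card_kerProds (hf.mono (Multiset.le_add_right V R)) hV
  have h2 := hR.card_lt
  have h3 := Finset.card_le_card (c.kerProds_mono (Multiset.le_add_right V R))
  rw [Multiset.card_map] at h2
  rw [Multiset.card_add]
  omega

include c in
theorem card_le_of_productOneFree [NeZero p] {S : Multiset G} (hf : ProductOneFree S) :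
    S.card + 2 ≤ m + p :=
  (c.card_le_card_kerProds_add hf).trans (Nat.add_le_add_right (c.card_kerProds_le S) p)

end FrobeniusCoord

/-! ### The case of equality: classes of the terms in C_p -/

namespace FrobeniusCoord

variable {G : Type*} [Group G] {p m : ℕ} (c : FrobeniusCoord G p m) [NeZero m]

/-- A sequence that attains the general lower bound for its number of products in the kernel. -/
def Tight (S : Multiset G) : Prop := (c.kerProds S).card + p ≤ S.card + 2

theorem tight_of_card {S : Multiset G} (h : S.card + 2 = m + p) : c.Tight S := by
  have := c.card_kerProds_le S
  unfold Tight
  omega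

/-- `V` adds at least `V.card` kernel elements, so any slack in `S` would persist in `V + S`. -/
theorem Tight.of_add {V S : Multiset G} (hf : ProductOneFree (V + S)) (hV : c.expSum V = 0)
    (h : c.Tight (V + S)) : c.Tight S := by
  have h1 := c.card_kerProds_add_le hf
  have h2 := c.card_lt_card_kerProds (hf.mono (Multiset.le_add_right V S)) hV
  unfold Tight at *
  rw [Multiset.card_add] at h
  omega

theorem Tight.card_kerProds_le_of_le {S T : Multiset G} (hf : ProductOneFree S) (h : c.Tight S)
    (hT : T ≤ S) (hs : c.expSum T = c.expSum S) : (c.kerProds T).card + p ≤ T.card + 2 := by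
  obtain ⟨V, rfl⟩ := Multiset.le_iff_exists_add.1 hT
  rw [add_comm] at h hf
  refine Tight.of_add c hf ?_ h
  rw [c.expSum_add] at hs
  simpa using hs

/-- The rest `R` is tight too, so its image in C_p is a longest zero-sum free sequence: p − 1 copies
of a generator g. Their sum −g is the exponent sum of `S`, so g does not depend on the splitting. -/
theorem Tight.count [NeZero p] {S : Multiset G} (hf : ProductOneFree S)
    (h : c.Tight S) : IsUnit (-c.expSum S) ∧ p ≤ (S.map c.e).count (-c.expSum S) + 1 := by
  obtain ⟨V, R, rfl, hV, hR⟩ := c.exists_add_zeroSumFree S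
  have hT := Tight.of_add c hf hV h
  have hpos : 1 ≤ (c.kerProds R).card := Finset.card_pos.2 ⟨0, c.zero_mem_kerProds R⟩
  unfold Tight at hT
  obtain ⟨g, hg, hRg⟩ := hR.eq_replicate (by rw [Multiset.card_map]; omega)
  have hp : 1 ≤ p := Nat.one_le_iff_ne_zero.2 (NeZero.ne p)
  have hsum : -c.expSum (V + R) = g := by
    rw [c.expSum_add, hV, zero_add, expSum, hRg, Multiset.sum_replicate, nsmul_eq_mul,
      Nat.cast_sub hp]
    simp
  rw [hsum, Multiset.map_add, Multiset.count_add, hRg, Multiset.count_replicate_self]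
  exact ⟨hg, by omega⟩

/-- In a tight sequence only one nontrivial class of `C_p` occurs. -/
theorem Tight.e_mem [Fact p.Prime] {S : Multiset G} (hf : ProductOneFree S) (h : c.Tight S) :
    (∀ s ∈ S, c.e s = 0 ∨ c.e s = -c.expSum S) ∧
      (S.map c.e).count (-c.expSum S) % p = p - 1 := by
  obtain ⟨hu, hcount⟩ := Tight.count c hf h
  set g := -c.expSum S with hg
  set n := (S.map c.e).count g with hn
  have hp2 : 2 ≤ p := (Fact.out : p.Prime).two_le
  -- Removing `W` preserves tightness and the exponent sum, so at least p − 1 terms of class g must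
  -- remain.
  have hrem : ∀ W ≤ S, c.expSum W = 0 → p ≤ (S.map c.e).count g - (W.map c.e).count g + 1 := by
    intro W hW hW0
    obtain ⟨X, rfl⟩ := Multiset.le_iff_exists_add.1 hW
    have h1 := (Tight.count c (hf.mono (Multiset.le_add_left X W)) (Tight.of_add c hf hW0 h)).2
    have h2 : -c.expSum X = g := by rw [hg, c.expSum_add, hW0, zero_add]
    rw [h2] at h1
    rw [Multiset.map_add, Multiset.count_add]
    omega
  have hmod : n % p = p - 1 := by
    obtain ⟨W, hW, hWm⟩ := Multiset.exists_le_map_eq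
      (Multiset.le_count_iff_replicate_le.1 (show p * (n / p) ≤ (S.map c.e).count g from
        Nat.mul_div_le n p))
    have h1 := hrem W hW (by simp [expSum, hWm])
    rw [hWm, Multiset.count_replicate_self, ← hn] at h1
    have := Nat.mod_add_div n p
    have := Nat.mod_lt n (show 0 < p by omega)
    omega
  refine ⟨fun s hs => ?_, hmod⟩
  by_contra hcon
  push Not at hcon
  obtain ⟨hs0, hsg⟩ := hcon
  -- A term `s` of a third class and `j` ≥ 1 terms of class g have exponent sum zero. Removing them
  -- along with p⌊n/p⌋ further terms of class g leaves only p − 1 − j such terms.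
  set j := (-c.e s / g).val with hj
  have hg0 : g ≠ 0 := hu.ne_zero
  have hjp : j < p := ZMod.val_lt _
  have hj0 : j ≠ 0 := by
    intro hj0
    rw [hj, ZMod.val_eq_zero, div_eq_zero_iff, neg_eq_zero] at hj0
    tauto
  obtain ⟨X, hX⟩ := Multiset.exists_cons_of_mem hs
  have hcX : (X.map c.e).count g = n := by
    rw [hn, hX, Multiset.map_cons, Multiset.count_cons_of_ne (Ne.symm hsg)]
  have hnp := Nat.mod_add_div n p
  obtain ⟨W, hW, hWm⟩ := Multiset.exists_le_map_eq
    (Multiset.le_count_iff_replicate_le.1 (show p * (n / p) + j ≤ (X.map c.e).count g by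
      rw [hcX]; omega))
  have h1 := hrem (s ::ₘ W) (by rw [hX]; exact Multiset.cons_le_cons s hW) (by
    have hjc : ((j : ℕ) : ZMod p) = -c.e s / g := by simp [hj]
    simp only [expSum, Multiset.map_cons, Multiset.sum_cons, hWm, Multiset.sum_replicate,
      nsmul_eq_mul]
    push_cast
    rw [hjc, CharP.cast_eq_zero]
    field_simp
    ring)
  rw [Multiset.map_cons, Multiset.count_cons_of_ne (Ne.symm hsg), hWm,
    Multiset.count_replicate_self, ← hn] at h1
  omega

end FrobeniusCoord

/-! ### Translates in ℤ/m, and 2p − 1 terms of one class for odd p -/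

theorem ZMod.exists_add_notMem {m p : ℕ} (hu : ∀ i : ℕ, 1 ≤ i → i ≤ p → IsUnit (i : ZMod m))
    {A : Finset (ZMod m)} (hA : A.Nonempty) (hAp : A.card ≤ p) {D : ZMod m} (hD : D ≠ 0) :
    ∃ a ∈ A, a + D ∉ A := by
  by_contra hcon
  push Not at hcon
  -- If translation by D permutes A, comparing sums gives |A| · D = 0, although |A| is a unit.
  have himg : A.image (· + D) = A := by
    refine Finset.eq_of_subset_of_card_le ?_ ?_
    · intro z hz
      obtain ⟨a, ha, rfl⟩ := Finset.mem_image.1 hz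
      exact hcon a ha
    · rw [Finset.card_image_of_injective _ (add_left_injective D)]
  have hsum : ∑ a ∈ A.image (· + D), a = ∑ a ∈ A, a := by rw [himg]
  rw [Finset.sum_image (fun a _ b _ h => add_left_injective D h), Finset.sum_add_distrib,
    Finset.sum_const, nsmul_eq_mul, add_eq_left] at hsum
  exact hD (((hu _ (Finset.card_pos.2 hA) hAp).mul_right_eq_zero).1 hsum)

/-- If `A ∪ (A + D)` is contained in a set of `p` elements with `#A ≥ p - 1`, then that set is an
arithmetic progression; its sum vanishes only if its middle term does. -/
theorem ZMod.zero_mem_of_sum_eq_zero {m p : ℕ} (hp : Odd p) (hp1 : 3 ≤ p)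
    (hu : ∀ i : ℕ, 1 ≤ i → i ≤ p → IsUnit (i : ZMod m)) {A P : Finset (ZMod m)}
    (hA : p ≤ A.card + 1) (hP : P.card ≤ p) {D : ZMod m} (hD : D ≠ 0) (hAP : A ⊆ P)
    (hADP : ∀ a ∈ A, a + D ∈ P) (hsum : ∑ a ∈ P, a = 0) : (0 : ZMod m) ∈ P := by
  have hAP' := Finset.card_le_card hAP
  have hA0 : A.Nonempty := Finset.card_pos.1 (by omega)
  obtain ⟨a₀, ha₀, ha₀'⟩ := ZMod.exists_add_notMem hu hA0 (by omega) hD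
  set w := a₀ + D with hw
  have hwP : w ∈ P := hADP a₀ ha₀
  have hlt : A.card < P.card :=
    Finset.card_lt_card ⟨hAP, fun hs => ha₀' (hs hwP)⟩
  have hAc : A.card = p - 1 := by omega
  have hPA : P = insert w A := by
    symm
    refine Finset.eq_of_subset_of_card_le (Finset.insert_subset hwP hAP) ?_
    rw [Finset.card_insert_of_notMem ha₀']
    omega
  set B := A.image (· + D) with hB
  have hBc : B.card = p - 1 := by
    rw [hB, Finset.card_image_of_injective _ (add_left_injective D), hAc]
  have hBP : B ⊆ P := by
    intro z hz
    obtain ⟨a, ha, rfl⟩ := Finset.mem_image.1 hz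
    exact hADP a ha
  obtain ⟨e, heP, heB⟩ : ∃ e ∈ P, e ∉ B := Finset.exists_mem_notMem_of_card_lt_card (by omega)
  have hPB : P = insert e B := by
    symm
    refine Finset.eq_of_subset_of_card_le (Finset.insert_subset heP hBP) ?_
    rw [Finset.card_insert_of_notMem heB]
    omega
  have hs1 : w + ∑ a ∈ A, a = 0 := by
    rw [hPA, Finset.sum_insert ha₀'] at hsum
    exact hsum
  have hs2 : e + (∑ a ∈ A, a + ((p - 1 : ℕ) : ZMod m) * D) = 0 := by
    rw [hPB, Finset.sum_insert heB, hB,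
      Finset.sum_image (fun a _ b _ h => add_left_injective D h), Finset.sum_add_distrib,
      Finset.sum_const, nsmul_eq_mul, hAc] at hsum
    exact hsum
  -- P is both A with w added and A + D with e added; equating the two sums locates e. Stepping back
  -- from w by D thus stays in P until e is reached, which takes p − 1 steps.
  have hwe : w - e = ((p - 1 : ℕ) : ZMod m) * D := by linear_combination hs1 - hs2
  have hchain : ∀ j : ℕ, j < p → w - j * D ∈ P := by
    intro j
    induction j with
    | zero => intro _; simpa using hwP
    | succ j ih =>
      intro hj
      have hz := ih (by omega)
      rw [hPB, Finset.mem_insert] at hz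
      rcases hz with hz | hz
      · exfalso
        have h1 : ((p - 1 - j : ℕ) : ZMod m) * D = 0 := by
          rw [Nat.cast_sub (by omega)]
          linear_combination hz - hwe
        exact hD (((hu _ (by omega) (by omega)).mul_right_eq_zero).1 h1)
      · obtain ⟨a, ha, haz⟩ := Finset.mem_image.1 hz
        apply hAP
        have : w - ((j + 1 : ℕ) : ZMod m) * D = a := by
          push_cast
          linear_combination -haz
        rwa [this]
  have hinj : Set.InjOn (fun j : ℕ => w - j * D) (Finset.range p : Set ℕ) := by
    have key : ∀ i j : ℕ, i < j → j < p → w - i * D ≠ w - j * D := by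
      intro i j hij hj h
      have h1 : ((j - i : ℕ) : ZMod m) * D = 0 := by
        rw [Nat.cast_sub hij.le]
        linear_combination h
      exact hD (((hu _ (by omega) (by omega)).mul_right_eq_zero).1 h1)
    intro i hi j hj hij
    simp only [Finset.coe_range, Set.mem_Iio] at hi hj
    by_contra hne
    rcases lt_or_gt_of_ne hne with h | h
    · exact key i j h hj hij
    · exact key j i h hi hij.symm
  have hPimg : P = (Finset.range p).image (fun j : ℕ => w - j * D) := by
    symm
    refine Finset.eq_of_subset_of_card_le ?_ ?_
    · intro z hz
      obtain ⟨j, hj, rfl⟩ := Finset.mem_image.1 hz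
      exact hchain j (Finset.mem_range.1 hj)
    · rw [Finset.card_image_of_injOn hinj, Finset.card_range]
      exact hP
  obtain ⟨k, hk⟩ := hp
  have hgauss : (∑ j ∈ Finset.range p, (j : ZMod m)) = (p : ZMod m) * k := by
    have h1 : ∑ j ∈ Finset.range p, j = p * k := by
      have h2 := Finset.sum_range_id_mul_two p
      have h3 : p - 1 = 2 * k := by omega
      rw [h3] at h2
      nlinarith
    rw [← Nat.cast_sum, h1]
    push_cast
    ring
  -- With p = 2k + 1, the sum of the progression is p times its middle term w − kD.
  have hs3 : (p : ZMod m) * (w - k * D) = 0 := by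
    rw [hPimg, Finset.sum_image hinj, Finset.sum_sub_distrib, ← Finset.sum_mul, hgauss,
      Finset.sum_const, Finset.card_range, nsmul_eq_mul] at hsum
    linear_combination hsum
  have hs4 := ((hu p (by omega) le_rfl).mul_right_eq_zero).1 hs3
  have := hchain k (by omega)
  rwa [hs4] at this

namespace FrobeniusCoord

variable {G : Type*} [Group G] {p m : ℕ} (c : FrobeniusCoord G p m)

theorem expSum_of_forall_eq {T : Multiset G} {g : ZMod p} (hT : ∀ s ∈ T, c.e s = g) :
    c.expSum T = T.card * g := by
  rw [expSum, Multiset.map_congr rfl hT, Multiset.map_const', Multiset.sum_replicate,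
    nsmul_eq_mul]

/-- The power g^p lies in the kernel and commutes with g, whose action fixes only 0. -/
theorem pow_eq_one_of_e_ne_zero {g : G} (hg : c.e g ≠ 0) (hp : p ≠ 0) : g ^ p = 1 := by
  obtain ⟨n, rfl⟩ := Nat.exists_eq_succ_of_ne_zero hp
  have h0 : c.e (g * g ^ n) = 0 := by
    have h1 := c.e_prod_coe (List.replicate (n + 1) g)
    rw [List.prod_replicate, c.expSum_of_forall_eq (g := c.e g)
      (fun s hs => by rw [Multiset.mem_coe] at hs; rw [List.eq_of_mem_replicate hs])] at h1
    rw [← pow_succ', h1]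
    simp
  have h1 := c.b_mul_comm h0
  rw [← pow_succ, ← pow_succ'] at h1
  rw [← pow_succ'] at h0
  refine c.eq_one_iff.2 ⟨h0, ((c.isUnit_ρ_sub_one _ hg).mul_right_eq_zero).1 ?_⟩
  linear_combination -h1

/-- Products over a choice of one entry from each pair take many values. -/
theorem exists_choice_values (hu : ∀ i : ℕ, 1 ≤ i → i ≤ p → IsUnit (i : ZMod m)) {g : ZMod p}
    (prs : List (G × G)) (hprs : ∀ q ∈ prs, c.e q.1 = g ∧ c.e q.2 = g ∧ c.b q.1 ≠ c.b q.2)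
    (hlen : prs.length ≤ p) :
    ∃ A : Finset (ZMod m), prs.length + 1 ≤ A.card ∧
      ∀ z ∈ A, ∃ l : List G, List.Forall₂ (fun a q => a = q.1 ∨ a = q.2) l prs ∧
        c.e l.prod = prs.length * g ∧ c.b l.prod = z := by
  induction prs with
  | nil =>
    refine ⟨{0}, by simp, fun z hz => ⟨[], List.Forall₂.nil, ?_, ?_⟩⟩
    · simpa using c.e_one
    · rw [Finset.mem_singleton.1 hz]
      simpa using c.b_one
  | cons q prs ih =>
    obtain ⟨A, hA, hAl⟩ := ih (fun q hq => hprs q (List.mem_cons_of_mem _ hq))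
      (by rw [List.length_cons] at hlen; omega)
    obtain ⟨h1, h2, h3⟩ := hprs q List.mem_cons_self
    rw [List.length_cons] at hlen ⊢
    set k := c.ρ (prs.length * g) with hk
    have hex : ∀ a, c.e a = g → (a = q.1 ∨ a = q.2) → ∀ z ∈ A, ∃ l : List G,
        List.Forall₂ (fun a q => a = q.1 ∨ a = q.2) l (q :: prs) ∧
        c.e l.prod = ((prs.length + 1 : ℕ) : ZMod p) * g ∧ c.b l.prod = z + c.b a * k := by
      intro a ha haq z hz
      obtain ⟨l, hl, hle, hlb⟩ := hAl z hz
      refine ⟨a :: l, List.Forall₂.cons haq hl, ?_, ?_⟩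
      · rw [List.prod_cons, c.e_mul, hle, ha]
        push_cast
        ring
      · rw [List.prod_cons, c.b_mul, hle, hlb, add_comm]
    refine ⟨A.image (· + c.b q.1 * k) ∪ A.image (· + c.b q.2 * k), ?_, ?_⟩
    · have hc1 : (A.image (· + c.b q.1 * k)).card = A.card :=
        Finset.card_image_of_injective _ (add_left_injective _)
      have hc2 := Finset.card_le_card
        (Finset.subset_union_left (s₁ := A.image (· + c.b q.1 * k))
          (s₂ := A.image (· + c.b q.2 * k)))
      by_cases hAc : A.card ≤ p
      · have hD : (c.b q.2 - c.b q.1) * k ≠ 0 := fun h =>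
          h3 (sub_eq_zero.1 (((c.isUnit_ρ _).mul_left_eq_zero).1 h)).symm
        obtain ⟨a, ha, ha'⟩ := ZMod.exists_add_notMem hu (Finset.card_pos.1 (by omega)) hAc hD
        have : A.card < (A.image (· + c.b q.1 * k) ∪ A.image (· + c.b q.2 * k)).card := by
          rw [← hc1]
          refine Finset.card_lt_card ⟨Finset.subset_union_left, fun hs => ha' ?_⟩
          have := hs (Finset.mem_union_right _ (Finset.mem_image_of_mem _ ha))
          obtain ⟨a', ha₁, ha₂⟩ := Finset.mem_image.1 this
          have : a + (c.b q.2 - c.b q.1) * k = a' := by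
            linear_combination -ha₂
          rwa [this]
        omega
      · omega
    · intro z hz
      rcases Finset.mem_union.1 hz with hz | hz
      · obtain ⟨z, hzA, rfl⟩ := Finset.mem_image.1 hz
        exact hex _ h1 (Or.inl rfl) z hzA
      · obtain ⟨z, hzA, rfl⟩ := Finset.mem_image.1 hz
        exact hex _ h2 (Or.inr rfl) z hzA

theorem coe_le_of_forall₂ {α : Type*} {l : List α} {prs : List (α × α)}
    (h : List.Forall₂ (fun a q => a = q.1 ∨ a = q.2) l prs) :
    (l : Multiset α) ≤ (prs.map Prod.fst : List α) + (prs.map Prod.snd : List α) := by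
  induction h with
  | nil => simp
  | @cons a q l prs haq _ ih =>
    rw [List.map_cons, List.map_cons, ← Multiset.cons_coe, ← Multiset.cons_coe,
      ← Multiset.cons_coe, Multiset.cons_add, Multiset.add_cons]
    rcases haq with rfl | rfl
    · exact Multiset.cons_le_cons _ (ih.trans (Multiset.le_cons_self _ _))
    · rw [Multiset.cons_swap]
      exact Multiset.cons_le_cons _ (ih.trans (Multiset.le_cons_self _ _))

/-- A sequence in which no element occurs `p` times can be ordered so that entries at distance
`p` differ. -/
theorem exists_list_getElem_ne {α : Type*} (T : Multiset α) {p : ℕ}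
    (h : ∀ a, ¬ Multiset.replicate p a ≤ T) :
    ∃ L : List α, (L : Multiset α) = T ∧
      ∀ (i : ℕ) (hi : i + p < L.length), L[i] ≠ L[i + p] := by
  classical
  -- Any linear order will do: in a sorted list, equal entries at distance p make everything between
  -- them equal.
  let _ : LinearOrder α := linearOrderOfSTO WellOrderingRel
  refine ⟨T.sort, Multiset.sort_eq T _, fun i hi heq => ?_⟩
  have hs : (T.sort).Pairwise (· ≤ ·) := Multiset.pairwise_sort T _
  have hmono : ∀ j k (hjk : j ≤ k) (hk : k < (T.sort).length), (T.sort)[j] ≤ (T.sort)[k] := by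
    intro j k hjk hk
    rcases hjk.eq_or_lt with rfl | hlt
    · exact le_rfl
    · exact List.pairwise_iff_getElem.1 hs j k _ hk hlt
  refine h (T.sort)[i] ?_
  have hrep : ((T.sort).drop i).take p = List.replicate p (T.sort)[i] := by
    refine List.ext_getElem (by
      rw [List.length_take, List.length_drop, List.length_replicate]; omega) fun j h1 h2 => ?_
    rw [List.length_replicate] at h2
    rw [List.getElem_take, List.getElem_drop, List.getElem_replicate]
    refine le_antisymm ?_ (hmono _ _ (by omega) _)
    rw [heq]
    exact hmono _ _ (by omega) _
  have hle : ((((T.sort).drop i).take p : List α) : Multiset α) ≤ (T.sort : Multiset α) :=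
    Multiset.coe_le.2 ((List.take_sublist _ _).trans (List.drop_sublist _ _)).subperm
  rw [hrep, Multiset.sort_eq, Multiset.coe_replicate] at hle
  exact hle

variable [NeZero m]

/-- Moving the first factor of a product to the end multiplies its kernel coordinate by ρ(g). So the
set is stable under ρ(g), and its sum is annihilated by the unit ρ(g) − 1. -/
theorem sum_kerProds_erase_eq_zero {T : Multiset G} {g : ZMod p} (hg : g ≠ 0)
    (hT : ∀ s ∈ T, c.e s = g) : ∑ z ∈ (c.kerProds T).erase 0, z = 0 := by
  set P := (c.kerProds T).erase 0 with hP
  have hinj : Function.Injective (fun z : ZMod m => c.ρ g * z) := (c.isUnit_ρ g).mul_right_injective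
  have himg : P.image (fun z => c.ρ g * z) = P := by
    refine Finset.eq_of_subset_of_card_le ?_ (Finset.card_image_of_injective _ hinj).ge
    intro y hy
    obtain ⟨z, hz, rfl⟩ := Finset.mem_image.1 hy
    obtain ⟨hz0, hz⟩ := Finset.mem_erase.1 hz
    refine Finset.mem_erase.2 ⟨fun h => hz0 (((c.isUnit_ρ g).mul_right_eq_zero).1 h), ?_⟩
    obtain ⟨l, hl, hle, rfl⟩ := c.mem_kerProds.1 hz
    cases l with
    | nil => exact absurd (by simpa using c.b_one) hz0
    | cons a l =>
      have hag : c.e a = g := hT a (Multiset.mem_of_le hl (by simp))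
      refine c.mem_kerProds.2 ⟨l ++ [a], ?_, ?_, ?_⟩
      · rw [← Multiset.coe_add, add_comm, Multiset.coe_add]
        simpa using hl
      · rw [List.prod_append, List.prod_singleton, c.e_mul, add_comm, ← c.e_mul, ← List.prod_cons,
          hle]
      · rw [List.prod_append, List.prod_singleton, c.b_mul_comm (by rw [← List.prod_cons, hle]),
          ← List.prod_cons, hag]
  have h1 : ∑ z ∈ P.image (fun z => c.ρ g * z), z = ∑ z ∈ P, z := by rw [himg]
  rw [Finset.sum_image (fun a _ b _ h => hinj h), ← Finset.mul_sum] at h1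
  refine ((c.isUnit_ρ_sub_one g hg).mul_right_eq_zero).1 ?_
  linear_combination h1

theorem lt_card_kerProds_of_odd [Fact p.Prime] (hodd : Odd p)
    (hu : ∀ i : ℕ, 1 ≤ i → i ≤ p → IsUnit (i : ZMod m)) {T : Multiset G} (hf : ProductOneFree T)
    {g : ZMod p} (hg : g ≠ 0) (hT : ∀ s ∈ T, c.e s = g) (hcard : T.card = 2 * p - 1) :
    p + 1 < (c.kerProds T).card := by
  have hp2 : 2 ≤ p := (Fact.out : p.Prime).two_le
  have hp3 : 3 ≤ p := by
    obtain ⟨k, hk⟩ := hodd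
    omega
  by_contra hlt
  have hcP := Finset.card_erase_of_mem (c.zero_mem_kerProds T)
  obtain ⟨L, hL, hLne⟩ := exists_list_getElem_ne T (p := p) (by
    intro a ha
    have ha' : a ∈ T := Multiset.mem_of_le ha (Multiset.mem_replicate.2 ⟨by omega, rfl⟩)
    have := productOneFree_iff.1 hf (List.replicate p a)
      (by rw [Multiset.coe_replicate]; exact ha) (by
      rw [List.prod_replicate]
      exact c.pow_eq_one_of_e_ne_zero (by rw [hT a ha']; exact hg) (by omega))
    have := congrArg List.length this
    simp at this
    omega)
  have hLlen : L.length = 2 * p - 1 := by rw [← hcard, ← hL, Multiset.coe_card]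
  have hLe : ∀ s ∈ L, c.e s = g := fun s hs => hT s (by rw [← hL]; exact hs)
  -- The list is X, z₀, Y, and the i-th entries of X and Y are at distance p in it, hence different.
  -- One entry from each of the p − 1 pairs, together with z₀, makes p terms, whose product lies in
  -- the kernel.
  set X := L.take (p - 1) with hX
  set Y := L.drop p with hY
  have hXlen : X.length = p - 1 := by rw [hX, List.length_take]; omega
  have hYlen : Y.length = p - 1 := by rw [hY, List.length_drop]; omega
  obtain ⟨z₀, hLsplit⟩ : ∃ z₀, X ++ z₀ :: Y = L := by
    have hz : p - 1 < L.length := by omega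
    refine ⟨L[p - 1], ?_⟩
    have h1 : L.drop (p - 1) = L[p - 1] :: L.drop (p - 1 + 1) := List.drop_eq_getElem_cons hz
    rw [show p - 1 + 1 = p by omega] at h1
    rw [hX, hY, ← h1, List.take_append_drop]
  obtain ⟨q, prs, hprs⟩ : ∃ q prs, X.zip Y = q :: prs := by
    refine List.exists_cons_of_length_pos ?_
    rw [List.length_zip]
    omega
  have hlen : prs.length = p - 2 := by
    have := congrArg List.length hprs
    rw [List.length_zip, List.length_cons] at this
    omega
  have hprop : ∀ r ∈ q :: prs, c.e r.1 = g ∧ c.e r.2 = g ∧ c.b r.1 ≠ c.b r.2 := by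
    intro r hr
    rw [← hprs] at hr
    obtain ⟨i, hi, rfl⟩ := List.mem_iff_getElem.1 hr
    have hi' : i < p - 1 := by
      rw [List.length_zip] at hi
      omega
    rw [List.getElem_zip]
    have e1 : X[i] = L[i] := by simp [hX]
    have e2 : Y[i] = L[i + p] := by simp [hY, add_comm]
    simp only [e1, e2]
    have h1 := hLe L[i] (List.getElem_mem _)
    have h2 := hLe L[i + p] (List.getElem_mem _)
    exact ⟨h1, h2, fun h3 => hLne i (by omega) (c.ext _ _ (h1.trans h2.symm) h3)⟩
  obtain ⟨A, hA, hAl⟩ := c.exists_choice_values hu prs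
    (fun r hr => hprop r (List.mem_cons_of_mem _ hr)) (by omega)
  obtain ⟨hq1, hq2, hq3⟩ := hprop q List.mem_cons_self
  set k := c.ρ (prs.length * g) with hk
  have hz0 : c.e z₀ = g := hLe _ (by rw [← hLsplit]; simp)
  set t := c.b z₀ * c.ρ (g + prs.length * g) with ht
  have hmem : ∀ a, c.e a = g → (a = q.1 ∨ a = q.2) → ∀ z ∈ A,
      z + c.b a * k + t ∈ (c.kerProds T).erase 0 := by
    intro a ha haq z hzA
    obtain ⟨l, hl, hle, hlb⟩ := hAl z hzA
    have hsub : ((z₀ :: a :: l : List G) : Multiset G) ≤ T := by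
      have h1 := coe_le_of_forall₂ (List.Forall₂.cons haq hl)
      rw [← hprs, List.map_fst_zip (by omega), List.map_snd_zip (by omega)] at h1
      rw [← hL, ← hLsplit, ← Multiset.cons_coe, ← Multiset.coe_add, ← Multiset.cons_coe (l := Y),
        Multiset.add_cons]
      exact Multiset.cons_le_cons _ h1
    have he : c.e (z₀ :: a :: l).prod = 0 := by
      rw [List.prod_cons, List.prod_cons, c.e_mul, c.e_mul, hle, ha, hz0, hlen]
      have : ((p - 2 : ℕ) : ZMod p) + 2 = 0 := by
        have : ((p - 2 + 2 : ℕ) : ZMod p) = 0 := by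
          rw [Nat.sub_add_cancel hp2]
          simp
        exact_mod_cast this
      linear_combination g * this
    have hb : c.b (z₀ :: a :: l).prod = z + c.b a * k + t := by
      rw [List.prod_cons, List.prod_cons, c.b_mul, c.b_mul, c.e_mul, hle, ha, hlb]
      ring
    refine Finset.mem_erase.2 ⟨fun h0 => ?_, c.mem_kerProds.2 ⟨_, hsub, he, hb⟩⟩
    have := productOneFree_iff.1 hf _ hsub (c.eq_one_iff.2 ⟨he, hb.trans h0⟩)
    simp at this
  -- The pairs `prs` give p − 1 values, and the two entries of the remaining pair `q` give a set and
  -- its translate, both among the at most p nonzero kernel products.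
  have h0 := ZMod.zero_mem_of_sum_eq_zero hodd hp3 hu
    (A := A.image (· + (c.b q.1 * k + t))) (P := (c.kerProds T).erase 0)
    (D := (c.b q.2 - c.b q.1) * k)
    (by rw [Finset.card_image_of_injective _ (add_left_injective _)]; omega) (by omega)
    (fun h => hq3 (sub_eq_zero.1 (((c.isUnit_ρ _).mul_left_eq_zero).1 h)).symm)
    (by
      intro y hy
      obtain ⟨z, hzA, rfl⟩ := Finset.mem_image.1 hy
      simpa only [add_assoc] using hmem q.1 hq1 (Or.inl rfl) z hzA)
    (by
      intro y hy
      obtain ⟨z, hzA, rfl⟩ := Finset.mem_image.1 hy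
      have := hmem q.2 hq2 (Or.inr rfl) z hzA
      have heq : z + (c.b q.1 * k + t) + (c.b q.2 - c.b q.1) * k = z + c.b q.2 * k + t := by ring
      rwa [heq])
    (c.sum_kerProds_erase_eq_zero hg hT)
  exact (Finset.mem_erase.1 h0).1 rfl

end FrobeniusCoord

/-! ### Small units modulo m, and three terms outside the kernel for p = 2 -/

theorem ZMod.eq_one_of_ne_zero_of_two {a : ZMod 2} (ha : a ≠ 0) : a = 1 := by
  revert a
  decide

namespace FrobeniusCoord

variable {G : Type*} [Group G] {p m : ℕ} (c : FrobeniusCoord G p m) [NeZero m]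

-- Modulo a prime q ∣ m the element ρ(1) has order exactly p, so p ∣ q − 1. Hence every prime
-- divisor of m exceeds p.
include c in
omit [NeZero m] in
theorem isUnit_natCast (hp : p.Prime) (hcop : p.Coprime m) {i : ℕ} (hi : 1 ≤ i) (hip : i ≤ p) :
    IsUnit (i : ZMod m) := by
  rw [ZMod.isUnit_iff_coprime]
  refine Nat.coprime_of_dvd fun q hq hqi hqm => ?_
  have hqp : q < p := by
    refine lt_of_le_of_ne ((Nat.le_of_dvd (by omega) hqi).trans hip) ?_
    rintro rfl
    exact hq.one_lt.ne' (Nat.eq_one_of_dvd_coprimes hcop dvd_rfl hqm)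
  have hp1 : (1 : ZMod p) ≠ 0 := by
    have : Fact p.Prime := ⟨hp⟩
    exact one_ne_zero
  have : Fact q.Prime := ⟨hq⟩
  let f : ZMod m →+* ZMod q := ZMod.castHom hqm (ZMod q)
  set a := f (c.ρ 1) with ha
  have ha1 : a ≠ 1 := by
    intro h
    have := (c.isUnit_ρ_sub_one 1 hp1).map f
    rw [map_sub, ← ha, h, map_one, sub_self] at this
    exact not_isUnit_zero this
  have hpow : ∀ n : ℕ, c.ρ (n : ZMod p) = c.ρ 1 ^ n := by
    intro n
    induction n with
    | zero => simpa using c.ρ_zero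
    | succ n ih => rw [Nat.cast_succ, c.ρ_add, ih, pow_succ]
  have hap : a ^ p = 1 := by
    rw [ha, ← map_pow, ← hpow, CharP.cast_eq_zero, c.ρ_zero, map_one]
  have hap0 : a ≠ 0 := by
    intro h
    rw [h, zero_pow hp.ne_zero] at hap
    exact zero_ne_one hap
  have : Fact p.Prime := ⟨hp⟩
  have hord : orderOf a = p := orderOf_eq_prime hap ha1
  have hdvd : p ∣ q - 1 := by
    rw [← hord]
    exact orderOf_dvd_of_pow_eq_one (ZMod.pow_card_sub_one_eq_one hap0)
  have := Nat.le_of_dvd (Nat.sub_pos_of_lt hq.one_lt) hdvd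
  omega

end FrobeniusCoord

namespace FrobeniusCoord

variable {G : Type*} [Group G] {m : ℕ} (c : FrobeniusCoord G 2 m)

/-- The nontrivial class acts by inversion: ρ(1)² = 1 and ρ(1) − 1 is a unit, so ρ(1) = −1. -/
theorem b_mul_of_e_eq_one {u v : G} (hv : c.e v = 1) : c.b (u * v) = c.b v - c.b u := by
  have h1 : c.ρ 1 * c.ρ 1 = 1 := by
    rw [← c.ρ_add, ← c.ρ_zero]
    rfl
  have h2 : c.ρ 1 + 1 = 0 := by
    refine ((c.isUnit_ρ_sub_one 1 one_ne_zero).mul_right_eq_zero).1 ?_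
    linear_combination h1
  rw [c.b_mul, hv]
  linear_combination c.b u * h2

variable [NeZero m]

theorem sub_mem_kerProds {T : Multiset G} {u v : G} (h : {u, v} ≤ T) (hu : c.e u = 1)
    (hv : c.e v = 1) : c.b v - c.b u ∈ c.kerProds T := by
  refine c.mem_kerProds.2 ⟨[u, v], h, ?_, ?_⟩
  · rw [List.prod_cons, List.prod_singleton, c.e_mul, hu, hv]
    rfl
  · rw [List.prod_cons, List.prod_singleton, c.b_mul_of_e_eq_one hv]

omit [NeZero m] in
theorem b_ne_of_productOneFree {T : Multiset G} (hf : ProductOneFree T) {u v : G}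
    (h : {u, v} ≤ T) (hu : c.e u = 1) (hv : c.e v = 1) : c.b u ≠ c.b v := by
  intro hb
  have := productOneFree_iff.1 hf [u, v] h (by
    rw [List.prod_cons, List.prod_singleton, c.eq_one_iff, c.b_mul_of_e_eq_one hv, c.e_mul, hu, hv,
      hb, sub_self]
    exact ⟨rfl, rfl⟩)
  simp at this

/-- All differences of the three distinct coordinates lie in K = {0, d, −d}, where d = b(v) − b(u).
This forces b(w) − b(u) = −d, and then b(w) − b(v) = −2d can only be d. -/
theorem exists_three_torsion {u v w : G} (hf : ProductOneFree ({u, v, w} : Multiset G))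
    (hu : c.e u = 1) (hv : c.e v = 1) (hw : c.e w = 1)
    (hcard : (c.kerProds {u, v, w}).card ≤ 3) (h2 : IsUnit (2 : ZMod m)) :
    ∃ d : ZMod m, d ≠ 0 ∧ 3 * d = 0 ∧ d ∈ c.kerProds {u, v, w} ∧ -d ∈ c.kerProds {u, v, w} := by
  have huv : ({u, v} : Multiset G) ≤ {u, v, w} :=
    Multiset.cons_le_cons u (by simp)
  have huw : ({u, w} : Multiset G) ≤ {u, v, w} :=
    Multiset.cons_le_cons u (by simp)
  have hvw : ({v, w} : Multiset G) ≤ {u, v, w} := Multiset.le_cons_self _ _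
  have hvu : ({v, u} : Multiset G) ≤ {u, v, w} := by rwa [Multiset.pair_comm]
  have n1 := c.b_ne_of_productOneFree hf huv hu hv
  have n2 := c.b_ne_of_productOneFree hf huw hu hw
  have n3 := c.b_ne_of_productOneFree hf hvw hv hw
  have m1 := c.sub_mem_kerProds huv hu hv
  have m1' := c.sub_mem_kerProds hvu hv hu
  have m2 := c.sub_mem_kerProds huw hu hw
  have m3 := c.sub_mem_kerProds hvw hv hw
  set d := c.b v - c.b u with hd
  have hd0 : d ≠ 0 := sub_ne_zero.2 n1.symm
  have hneg : c.b u - c.b v = -d := by rw [hd]; ring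
  rw [hneg] at m1'
  have hdd : d ≠ -d := by
    intro h
    refine hd0 ((h2.mul_right_eq_zero).1 ?_)
    linear_combination h
  have hsub : ({0, d, -d} : Finset (ZMod m)) ⊆ c.kerProds {u, v, w} := by
    intro z hz
    simp only [Finset.mem_insert, Finset.mem_singleton] at hz
    rcases hz with rfl | rfl | rfl
    · exact c.zero_mem_kerProds _
    · exact m1
    · exact m1'
  have hc : ({0, d, -d} : Finset (ZMod m)).card = 3 := by
    rw [Finset.card_insert_of_notMem, Finset.card_pair hdd]
    simp only [Finset.mem_insert, Finset.mem_singleton, not_or]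
    exact ⟨hd0.symm, fun h => hd0 (by rw [← neg_neg d, ← h, neg_zero])⟩
  have heq := Finset.eq_of_subset_of_card_le hsub (by omega)
  rw [← heq] at m2 m3
  simp only [Finset.mem_insert, Finset.mem_singleton] at m2 m3
  refine ⟨d, hd0, ?_, m1, m1'⟩
  have k2 : c.b w - c.b u = -d := by
    rcases m2 with h | h | h
    · exact absurd (sub_eq_zero.1 h) n2.symm
    · exact absurd (sub_left_injective (h.trans hd)) n3.symm
    · exact h
  rcases m3 with h | h | h
  · exact absurd (sub_eq_zero.1 h) n3.symm
  · linear_combination k2 - h - hd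
  · exact absurd (by linear_combination k2 - h - hd) hd0

/-- For `p = 2` a sequence of maximal length with three terms outside the kernel consists of these
three terms only. -/
theorem eq_of_three_le {S : Multiset G} (hf : ProductOneFree S) (hS : c.Tight S)
    (h2 : IsUnit (2 : ZMod m)) {u v w : G} (hT : {u, v, w} ≤ S)
    (hu : c.e u = 1) (hv : c.e v = 1) (hw : c.e w = 1) (hs : c.expSum S = 1) :
    S = {u, v, w} := by
  set T : Multiset G := {u, v, w} with hTdef
  have hTs : c.expSum T = 1 := by
    simp only [expSum, hTdef, Multiset.insert_eq_cons, Multiset.map_cons, Multiset.sum_cons,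
      Multiset.map_singleton, Multiset.sum_singleton, hu, hv, hw]
    rfl
  have hTc : T.card = 3 := by simp [hTdef]
  have hc := Tight.card_kerProds_le_of_le c hf hS hT (hTs.trans hs.symm)
  obtain ⟨d, hd0, hd3, hdm, hdm'⟩ := c.exists_three_torsion (hf.mono hT) hu hv hw
    (by rw [← hTdef]; omega) h2
  rw [← hTdef] at hdm hdm'
  obtain ⟨V, rfl⟩ := Multiset.le_iff_exists_add.1 hT
  by_contra hne
  have hV0 : V ≠ 0 := by
    rintro rfl
    simp at hne
  have hVs : c.expSum V = 0 := by
    rw [c.expSum_add, hTs] at hs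
    simpa using hs
  obtain ⟨W, hW, hW0, hWs, hmin⟩ := c.exists_minimal_expSum_eq_zero hV0 hVs
  have hTW : T + W ≤ T + V := add_le_add le_rfl hW
  have hfTW := hf.mono hTW
  have hcard := Tight.card_kerProds_le_of_le c hf hS hTW (by
    rw [c.expSum_add, c.expSum_add, hWs, hVs])
  have hW1 := c.card_lt_card_kerProds (hfTW.mono (Multiset.le_add_left W T)) hWs
  have hWpos := Multiset.card_pos.2 hW0
  -- A minimal block minus one term is zero-sum free in C_2, so it has at most one term.
  have hW2 : W.card ≤ 2 := by
    obtain ⟨a, ha⟩ := Multiset.exists_mem_of_ne_zero hW0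
    obtain ⟨X, rfl⟩ := Multiset.exists_cons_of_mem ha
    have hX : ZeroSumFree (X.map c.e) := by
      intro t ht ht0
      obtain ⟨Y, hY, rfl⟩ := Multiset.exists_le_map_eq ht
      by_contra hY0
      have := hmin Y (hY.trans (Multiset.le_cons_self X a))
        (by rintro rfl; exact hY0 (Multiset.map_zero _)) ht0
      have h1 := Multiset.card_le_card hY
      rw [this, Multiset.card_cons] at h1
      omega
    have := hX.card_lt
    rw [Multiset.card_map] at this
    rw [Multiset.card_cons]
    omega
  obtain ⟨y, hy, hy0⟩ : ∃ y ∈ c.kerProds W, y ≠ 0 := by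
    obtain ⟨y, hy, hy'⟩ := Finset.exists_mem_notMem_of_card_lt_card
      (show ({0} : Finset (ZMod m)).card < (c.kerProds W).card by
        rw [Finset.card_singleton]; omega)
    exact ⟨y, hy, by simpa using hy'⟩
  have hyd : y ≠ d := by
    rintro rfl
    exact hy0 (c.eq_zero_of_add_eq_zero hfTW hdm' hy (neg_add_cancel _))
  have hyd' : y ≠ -d := by
    rintro rfl
    exact hy0 (c.eq_zero_of_add_eq_zero hfTW hdm hy (add_neg_cancel _))
  have h0 := c.zero_mem_kerProds T
  have h0' := c.zero_mem_kerProds W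
  -- The subgroup {0, d, −d} and its coset through y supply six kernel products, while tightness
  -- allows at most 3 + 2.
  have hsub : ({0, d, -d, y, d + y, -d + y} : Finset (ZMod m)) ⊆ c.kerProds (T + W) := by
    intro z hz
    simp only [Finset.mem_insert, Finset.mem_singleton] at hz
    rcases hz with rfl | rfl | rfl | rfl | rfl | rfl
    · exact c.zero_mem_kerProds _
    · simpa using c.add_mem_kerProds hdm h0'
    · simpa using c.add_mem_kerProds hdm' h0'
    · simpa using c.add_mem_kerProds h0 hy
    · exact c.add_mem_kerProds hdm hy
    · exact c.add_mem_kerProds hdm' hy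
  have hdd : d ≠ -d := fun h => hd0 (by linear_combination hd3 - h)
  have hc6 : ({0, d, -d, y, d + y, -d + y} : Finset (ZMod m)).card = 6 := by
    rw [Finset.card_insert_of_notMem, Finset.card_insert_of_notMem, Finset.card_insert_of_notMem,
      Finset.card_insert_of_notMem, Finset.card_pair]
    · intro h
      exact hdd (add_right_cancel h)
    all_goals
      simp only [Finset.mem_insert, Finset.mem_singleton, not_or]
    · exact ⟨fun h => hd0 (by linear_combination -h), fun h => hd0 (by linear_combination h)⟩
    · exact ⟨hyd'.symm, fun h => hyd (by linear_combination -h - hd3),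
        fun h => hy0 (by linear_combination -h)⟩
    · exact ⟨hdd, hyd.symm, fun h => hy0 (by linear_combination -h),
        fun h => hyd' (by linear_combination hd3 - h)⟩
    · exact ⟨hd0.symm, fun h => hd0 (by linear_combination h), hy0.symm,
        fun h => hyd' (by linear_combination -h), fun h => hyd (by linear_combination -h)⟩
  have := Finset.card_le_card hsub
  rw [Multiset.card_add] at hcard
  omega

end FrobeniusCoord

/-! ### The structure of extremal sequences and the converse -/

namespace FrobeniusCoord

variable {G : Type*} [Group G] {p m : ℕ} (c : FrobeniusCoord G p m) [NeZero m]

-- On the kernel the coordinate `b` is additive, so a zero sum is a product one in any order.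
omit [NeZero m] in
theorem zeroSumFree_map_b {U : Multiset G} (hf : ProductOneFree U) (hU : ∀ s ∈ U, c.e s = 0) :
    ZeroSumFree (U.map c.b) := by
  intro t ht ht0
  obtain ⟨Y, hY, rfl⟩ := Multiset.exists_le_map_eq ht
  have hY0 : ∀ s ∈ Y, c.e s = 0 := fun s hs => hU s (Multiset.mem_of_le hY hs)
  induction Y using Quotient.inductionOn with
  | _ l =>
  change ∀ s ∈ (l : Multiset G), c.e s = 0 at hY0
  have h1 : l = [] := by
    refine productOneFree_iff.1 hf l hY (c.eq_one_iff.2 ⟨?_, ?_⟩)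
    · rw [c.e_prod_coe, c.expSum_of_forall_eq (g := 0) hY0, mul_zero]
    · rw [c.b_prod_of_e_eq_zero l hY0]
      simpa using ht0
  subst h1
  rfl

/-- The structure of product-one free sequences of maximal length. -/
theorem eq_of_productOneFree [Fact p.Prime] (hcop : p.Coprime m) {S : Multiset G}
    (hf : ProductOneFree S) (hcard : S.card + 2 = m + p) :
    (∃ g : ZMod p, g ≠ 0 ∧ ∃ R : Multiset G, ∃ h : G, R.card = p - 1 ∧ (∀ s ∈ R, c.e s = g) ∧
      c.e h = 0 ∧ IsUnit (c.b h) ∧ S = R + Multiset.replicate (m - 1) h) ∨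
    (p = 2 ∧ m = 3 ∧ S.Nodup ∧ ∀ s ∈ S, c.e s = 1) := by
  classical
  have hpp : p.Prime := Fact.out
  have hp2 := hpp.two_le
  have hT := c.tight_of_card hcard
  obtain ⟨hmem, hmod⟩ := Tight.e_mem c hf hT
  have hg0 : -c.expSum S ≠ 0 := (Tight.count c hf hT).1.ne_zero
  set g := -c.expSum S with hg
  set R := S.filter (fun s => c.e s = g) with hR
  set U := S.filter (fun s => ¬ c.e s = g) with hU
  have hS : R + U = S := Multiset.filter_add_not _ S
  have hRe : ∀ s ∈ R, c.e s = g := fun s hs => (Multiset.mem_filter.1 hs).2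
  have hUe : ∀ s ∈ U, c.e s = 0 := fun s hs =>
    (hmem s (Multiset.mem_filter.1 hs).1).resolve_right (Multiset.mem_filter.1 hs).2
  have hRc : R.card % p = p - 1 := by
    rw [Multiset.count_map] at hmod
    rw [hR, ← hmod]
    simp only [eq_comm]
  by_cases hRp : R.card = p - 1
  · left
    have hUc : U.card = m - 1 := by
      have := congrArg Multiset.card hS
      rw [Multiset.card_add] at this
      have := NeZero.ne m
      omega
    have hUz := c.zeroSumFree_map_b (hf.mono (hS ▸ Multiset.le_add_left U R)) hUe
    obtain ⟨z, hz, hUz'⟩ := hUz.eq_replicate (by rw [Multiset.card_map]; omega)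
    obtain ⟨h, hh, rfl⟩ := c.exists_coord 0 z
    refine ⟨g, hg0, R, h, hRp, hRe, hh, hz, ?_⟩
    have : U = Multiset.replicate (m - 1) h := by
      refine Multiset.eq_replicate.2 ⟨hUc, fun s hs => c.ext _ _ ((hUe s hs).trans hh.symm) ?_⟩
      have : c.b s ∈ U.map c.b := Multiset.mem_map_of_mem _ hs
      rw [hUz'] at this
      exact Multiset.eq_of_mem_replicate this
    rw [← this, hS]
  · right
    -- The number of terms of class g is −1 modulo p, so after p − 1 the next possible value is 2p −
    -- 1.
    have hRge : 2 * p - 1 ≤ R.card := by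
      have h1 := Nat.mod_add_div R.card p
      rcases Nat.eq_zero_or_pos (R.card / p) with h | h
      · rw [h] at h1
        omega
      · have := Nat.mul_le_mul_left p h
        omega
    obtain ⟨T, hTR, hTc⟩ : ∃ T ≤ R, T.card = 2 * p - 1 := by
      refine ⟨(R.toList.take (2 * p - 1) : List G), ?_, ?_⟩
      · conv_rhs => rw [← Multiset.coe_toList R]
        exact Multiset.coe_le.2 (List.take_sublist _ _).subperm
      · rw [Multiset.coe_card, List.length_take, Multiset.length_toList]
        omega
    have hTS : T ≤ S := hTR.trans (hS ▸ Multiset.le_add_right R U)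
    have hTe : ∀ s ∈ T, c.e s = g := fun s hs => hRe s (Multiset.mem_of_le hTR hs)
    have hTs : c.expSum T = c.expSum S := by
      rw [c.expSum_of_forall_eq hTe, hTc, Nat.cast_sub (by omega)]
      push_cast
      rw [CharP.cast_eq_zero, hg]
      ring
    -- The 2p − 1 terms also have exponent sum −g, so tightness passes to `T`: at most p + 1 kernel
    -- products.
    have hk := Tight.card_kerProds_le_of_le c hf hT hTS hTs
    rcases hpp.eq_two_or_odd' with rfl | hodd
    · have hg1 : g = 1 := ZMod.eq_one_of_ne_zero_of_two hg0
      have hs1 : c.expSum S = 1 := by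
        rw [← neg_eq_iff_eq_neg.2 hg, hg1]
        rfl
      obtain ⟨u, v, w, rfl⟩ := Multiset.card_eq_three.1 hTc
      rw [hg1] at hTe
      have hu := hTe u (by simp)
      have hv := hTe v (by simp)
      have hw := hTe w (by simp)
      have hS3 := c.eq_of_three_le hf hT (c.isUnit_natCast hpp hcop (i := 2) (by omega) le_rfl) hTS
        hu hv hw hs1
      subst hS3
      refine ⟨rfl, ?_, ?_, hTe⟩
      · simp at hcard
        omega
      · rw [Multiset.nodup_iff_le]
        intro a ha
        have ha' : c.e a = 1 := hTe a (Multiset.mem_of_le ha (by simp))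
        exact c.b_ne_of_productOneFree hf ha ha' ha' rfl
    · have := c.lt_card_kerProds_of_odd hodd
        (fun i h1 h2 => c.isUnit_natCast hpp hcop h1 h2) (hf.mono hTS) hg0 hTe hTc
      omega

-- In a product-one subsequence the number of terms from `R` is divisible by p, hence zero. What
-- remains is k < m copies of `h`, and k · b(h) = 0 forces k = 0.
omit [NeZero m] in
theorem productOneFree_of_eq [Fact p.Prime] {g : ZMod p} (hg : g ≠ 0) {R : Multiset G} {h : G}
    (hRc : R.card < p) (hR : ∀ s ∈ R, c.e s = g) (hh : c.e h = 0) (hb : IsUnit (c.b h))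
    {n : ℕ} (hn : n < m) : ProductOneFree (R + Multiset.replicate n h) := by
  classical
  rw [productOneFree_iff]
  intro l hl h1
  set T : Multiset G := (l : Multiset G) with hT
  have hsplit : T.filter (fun s => c.e s = g) + T.filter (fun s => ¬ c.e s = g) = T :=
    Multiset.filter_add_not _ T
  have hhg : ¬ c.e h = g := by rw [hh]; exact hg.symm
  have hle1 : T.filter (fun s => c.e s = g) ≤ R := by
    refine (Multiset.filter_le_filter _ hl).trans ?_
    rw [Multiset.filter_add, (Multiset.filter_eq_nil (s := Multiset.replicate n h)).2, add_zero]
    · exact Multiset.filter_le _ _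
    · intro a ha
      rw [Multiset.eq_of_mem_replicate ha]
      exact hhg
  have hle2 : T.filter (fun s => ¬ c.e s = g) ≤ Multiset.replicate n h := by
    refine (Multiset.filter_le_filter _ hl).trans ?_
    rw [Multiset.filter_add, (Multiset.filter_eq_nil (s := R)).2, zero_add]
    · exact Multiset.filter_le _ _
    · intro a ha
      simpa using hR a ha
  obtain ⟨k, hk, hk2⟩ := Multiset.le_replicate_iff.1 hle2
  have hsum : c.expSum T = 0 := by rw [← c.e_prod_coe, h1, c.e_one]
  rw [← hsplit, c.expSum_add, c.expSum_of_forall_eq (g := g) (fun s hs => (Multiset.mem_filter.1 hs).2),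
    hk2, c.expSum_of_forall_eq (g := 0) (fun s hs => by rw [Multiset.eq_of_mem_replicate hs, hh]),
    mul_zero, add_zero, mul_eq_zero, or_iff_left hg, ZMod.natCast_eq_zero_iff] at hsum
  have hj := Nat.eq_zero_of_dvd_of_lt hsum ((Multiset.card_le_card hle1).trans_lt hRc)
  rw [Multiset.card_eq_zero] at hj
  rw [hj, zero_add, hk2, hT, ← Multiset.coe_replicate, Multiset.coe_eq_coe,
    List.replicate_perm] at hsplit
  subst hsplit
  have h2 := c.b_prod_of_e_eq_zero (List.replicate k h)
    (fun s hs => by rw [List.eq_of_mem_replicate hs, hh])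
  rw [h1, c.b_one, List.map_replicate, List.sum_replicate, nsmul_eq_mul, eq_comm,
    hb.mul_left_eq_zero, ZMod.natCast_eq_zero_iff] at h2
  rw [Nat.eq_zero_of_dvd_of_lt h2 (by omega)]
  rfl

end FrobeniusCoord

/-- A product-one subsequence has even length, so only pairs matter, and uv = 1 forces u = v because
these elements are involutions. -/
theorem FrobeniusCoord.productOneFree_of_nodup {G : Type*} [Group G] {m : ℕ}
    (c : FrobeniusCoord G 2 m) {S : Multiset G} (hS : S.Nodup) (hc : S.card ≤ 3)
    (he : ∀ s ∈ S, c.e s = 1) : ProductOneFree S := by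
  rw [productOneFree_iff]
  intro l hl h1
  have hle : ∀ s ∈ (l : Multiset G), c.e s = 1 := fun s hs => he s (Multiset.mem_of_le hl hs)
  have h2 := c.e_prod_coe l
  rw [h1, c.e_one, c.expSum_of_forall_eq hle, mul_one, Multiset.coe_card, eq_comm,
    ZMod.natCast_eq_zero_iff] at h2
  have h3 := (Multiset.card_le_card hl).trans hc
  rw [Multiset.coe_card] at h3
  match l, hl, h1, hle, h2, h3 with
  | [], _, _, _, _, _ => rfl
  | [_], _, _, _, h2, _ => simp at h2
  | [u, v], hl, h1, hle, _, _ =>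
    exfalso
    have hu := hle u (by simp)
    have hv := hle v (by simp)
    have h4 := (c.eq_one_iff.1 h1).2
    rw [List.prod_cons, List.prod_singleton, c.b_mul_of_e_eq_one hv, sub_eq_zero] at h4
    have h5 := c.ext _ _ (hv.trans hu.symm) h4
    have := Multiset.nodup_of_le hl hS
    rw [h5] at this
    simp at this
  | [_, _, _], _, _, _, h2, _ => norm_num at h2
  | _ :: _ :: _ :: _ :: _, _, _, _, _, h3 =>
    simp only [List.length_cons] at h3
    omega

/-! ### Normal form in the presented group -/

/-- The set `ℤ/p × ℤ/m` underlying a concrete model of `⟨x, y | x^p = y^m = 1, x⁻¹yx = y^r⟩`;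
`⟨i, j⟩` stands for `x^i y^j`. -/
@[ext]
structure MetacyclicModel (p m : ℕ) (r : ZMod m) where
  /-- the exponent of `x` -/
  e : ZMod p
  /-- the exponent of `y` -/
  b : ZMod m

theorem ZMod.pow_val_add {p : ℕ} [NeZero p] {M : Type*} [Monoid M] {a : M} (h : a ^ p = 1)
    (i j : ZMod p) : a ^ (i + j).val = a ^ i.val * a ^ j.val := by
  rw [ZMod.val_add, ← pow_eq_pow_mod _ h, pow_add]

namespace MetacyclicModel

variable {p m : ℕ} {r : ZMod m}

/-- The multiplication comes from the rule y^j x^k = x^k y^(j r^k). -/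
instance [NeZero p] [hr : Fact (r ^ p = 1)] : Group (MetacyclicModel p m r) where
  mul g h := ⟨g.e + h.e, g.b * r ^ h.e.val + h.b⟩
  one := ⟨0, 0⟩
  inv g := ⟨-g.e, -(g.b * r ^ (-g.e).val)⟩
  mul_assoc g h k := by
    refine MetacyclicModel.ext (add_assoc _ _ _) ?_
    change (g.b * r ^ h.e.val + h.b) * r ^ k.e.val + k.b =
      g.b * r ^ (h.e + k.e).val + (h.b * r ^ k.e.val + k.b)
    rw [ZMod.pow_val_add hr.out]
    ring
  one_mul g := by
    refine MetacyclicModel.ext (zero_add _) ?_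
    change 0 * r ^ g.e.val + g.b = g.b
    ring
  mul_one g := by
    refine MetacyclicModel.ext (add_zero _) ?_
    change g.b * r ^ (0 : ZMod p).val + 0 = g.b
    simp
  inv_mul_cancel g := by
    refine MetacyclicModel.ext (neg_add_cancel _) ?_
    change -(g.b * r ^ (-g.e).val) * r ^ g.e.val + g.b = 0
    have h := ZMod.pow_val_add hr.out (-g.e) g.e
    rw [neg_add_cancel, ZMod.val_zero, pow_zero] at h
    linear_combination g.b * h

variable [NeZero p] [hr : Fact (r ^ p = 1)]

theorem mul_e (g h : MetacyclicModel p m r) : (g * h).e = g.e + h.e := rfl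

theorem mul_b (g h : MetacyclicModel p m r) : (g * h).b = g.b * r ^ h.e.val + h.b := rfl

theorem one_e : (1 : MetacyclicModel p m r).e = 0 := rfl

theorem one_b : (1 : MetacyclicModel p m r).b = 0 := rfl

theorem mk_zero_right_pow (n : ℕ) : (⟨1, 0⟩ : MetacyclicModel p m r) ^ n = ⟨n, 0⟩ := by
  induction n with
  | zero => exact MetacyclicModel.ext (by simp [one_e]) (by simp [one_b])
  | succ n ih =>
    rw [pow_succ, ih]
    exact MetacyclicModel.ext (by simp [mul_e]) (by simp [mul_b])

theorem mk_zero_left_pow (n : ℕ) : (⟨0, 1⟩ : MetacyclicModel p m r) ^ n = ⟨0, n⟩ := by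
  induction n with
  | zero => exact MetacyclicModel.ext (by simp [one_e]) (by simp [one_b])
  | succ n ih =>
    rw [pow_succ, ih]
    exact MetacyclicModel.ext (by simp [mul_e]) (by simp [mul_b])

theorem mk_zero_left_zpow (n : ℤ) : (⟨0, 1⟩ : MetacyclicModel p m r) ^ n = ⟨0, n⟩ := by
  cases n with
  | ofNat n => simpa using mk_zero_left_pow n
  | negSucc n =>
    rw [zpow_negSucc, mk_zero_left_pow, inv_eq_iff_mul_eq_one]
    refine MetacyclicModel.ext (by simp [mul_e, one_e]) ?_
    rw [mul_b, one_b]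
    simp

end MetacyclicModel

namespace MetacyclicGroup

variable (p m : ℕ) (r : ℤ)

theorem x_pow : x p m r ^ p = 1 :=
  PresentedGroup.one_of_mem (rels := metacyclicRels p m r) (x := FreeGroup.of 0 ^ p)
    (by simp [metacyclicRels])

theorem y_pow : y p m r ^ m = 1 :=
  PresentedGroup.one_of_mem (rels := metacyclicRels p m r) (x := FreeGroup.of 1 ^ m)
    (by simp [metacyclicRels])

theorem conj_y : (x p m r)⁻¹ * y p m r * x p m r = y p m r ^ r := by
  have := PresentedGroup.one_of_mem (rels := metacyclicRels p m r)
    (x := (FreeGroup.of 0)⁻¹ * FreeGroup.of 1 * FreeGroup.of 0 * (FreeGroup.of 1 ^ r)⁻¹)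
    (by simp [metacyclicRels])
  exact mul_inv_eq_one.1 this

theorem y_zpow_mul_x (k : ℤ) : y p m r ^ k * x p m r = x p m r * y p m r ^ (r * k) := by
  have h1 : ((x p m r)⁻¹ * y p m r * x p m r) ^ k = (x p m r)⁻¹ * y p m r ^ k * x p m r := by
    simpa using conj_zpow (a := (x p m r)⁻¹) (b := y p m r) (i := k)
  rw [zpow_mul, ← conj_y, h1]
  group

theorem y_zpow_mul_x_pow (k : ℤ) (n : ℕ) :
    y p m r ^ k * x p m r ^ n = x p m r ^ n * y p m r ^ (r ^ n * k) := by
  induction n generalizing k with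
  | zero => simp
  | succ n ih =>
    rw [pow_succ', ← mul_assoc, y_zpow_mul_x, mul_assoc, ih, ← mul_assoc]
    congr 2
    ring

theorem y_zpow_congr {k l : ℤ} (h : (k : ZMod m) = l) : y p m r ^ k = y p m r ^ l := by
  rw [ZMod.intCast_eq_intCast_iff_dvd_sub] at h
  obtain ⟨t, ht⟩ := h
  rw [show l = k + m * t by linarith, zpow_add, zpow_mul, zpow_natCast, y_pow, one_zpow, mul_one]

variable [hp : Fact p.Prime] [hr : Fact ((r : ZMod m) ^ p = 1)]

/-- The homomorphism from the presented group to the model. -/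
def toModel : MetacyclicGroup p m r →* MetacyclicModel p m (r : ZMod m) :=
  PresentedGroup.toGroup (f := ![⟨1, 0⟩, ⟨0, 1⟩]) (by
    have h1 : (1 : ZMod p).val = 1 := ZMod.val_one p
    intro w hw
    simp only [metacyclicRels, Set.mem_insert_iff, Set.mem_singleton_iff] at hw
    rcases hw with rfl | rfl | rfl
    · simp only [map_pow, FreeGroup.lift_apply_of, Matrix.cons_val_zero,
        MetacyclicModel.mk_zero_right_pow, CharP.cast_eq_zero]
      rfl
    · simp only [map_pow, FreeGroup.lift_apply_of, Matrix.cons_val_one,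
        Matrix.cons_val_fin_one, MetacyclicModel.mk_zero_left_pow, CharP.cast_eq_zero]
      rfl
    · simp only [map_mul, map_inv, map_zpow, FreeGroup.lift_apply_of, Matrix.cons_val_zero,
        Matrix.cons_val_one, Matrix.cons_val_fin_one, MetacyclicModel.mk_zero_left_zpow]
      rw [mul_inv_eq_one, mul_assoc, inv_mul_eq_iff_eq_mul]
      refine MetacyclicModel.ext ?_ ?_
      · simp [MetacyclicModel.mul_e]
      · simp [MetacyclicModel.mul_b, h1])

theorem toModel_x : toModel p m r (x p m r) = ⟨1, 0⟩ := by
  simp [toModel, x]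

theorem toModel_y : toModel p m r (y p m r) = ⟨0, 1⟩ := by
  simp [toModel, y]

theorem toModel_x_pow_mul_y_pow (i j : ℕ) :
    toModel p m r (x p m r ^ i * y p m r ^ j) = ⟨i, j⟩ := by
  rw [map_mul, map_pow, map_pow, toModel_x, toModel_y, MetacyclicModel.mk_zero_right_pow,
    MetacyclicModel.mk_zero_left_pow]
  exact MetacyclicModel.ext (by simp [MetacyclicModel.mul_e]) (by simp [MetacyclicModel.mul_b])

variable [NeZero m]

/-- The normal form homomorphism from the model to the presented group. -/
def ofModel : MetacyclicModel p m (r : ZMod m) →* MetacyclicGroup p m r :=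
  MonoidHom.mk' (fun g => x p m r ^ g.e.val * y p m r ^ g.b.val) (by
    intro g h
    rw [MetacyclicModel.mul_e, ZMod.pow_val_add (x_pow p m r)]
    have h1 := y_zpow_mul_x_pow p m r (g.b.val : ℤ) h.e.val
    have h2 : y p m r ^ (g * h).b.val =
        y p m r ^ ((r : ℤ) ^ h.e.val * (g.b.val : ℤ)) * y p m r ^ (h.b.val : ℤ) := by
      rw [← zpow_natCast, ← zpow_add]
      apply y_zpow_congr
      rw [MetacyclicModel.mul_b]
      push_cast
      simp only [ZMod.natCast_val, ZMod.cast_id', id_eq]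
      ring
    rw [h2, ← zpow_natCast (y p m r) g.b.val, ← zpow_natCast (y p m r) h.b.val]
    calc _ = x p m r ^ g.e.val * (x p m r ^ h.e.val * y p m r ^ (r ^ h.e.val * (g.b.val : ℤ))) *
          y p m r ^ (h.b.val : ℤ) := by simp only [mul_assoc]
      _ = _ := by rw [← h1]; simp only [mul_assoc])

/-- It suffices to compare generators. Hence the model coordinates determine an element of the
presented group, and |G| = pm. -/
theorem ofModel_toModel (g : MetacyclicGroup p m r) : ofModel p m r (toModel p m r g) = g := by
  have : (ofModel p m r).comp (toModel p m r) = MonoidHom.id _ := by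
    refine PresentedGroup.ext fun i => ?_
    fin_cases i
    · change ofModel p m r (toModel p m r (x p m r)) = x p m r
      rw [toModel_x]
      simp [ofModel, ZMod.val_one p]
    · change ofModel p m r (toModel p m r (y p m r)) = y p m r
      rw [toModel_y]
      change x p m r ^ (0 : ZMod p).val * y p m r ^ (1 : ZMod m).val = y p m r
      rw [ZMod.val_zero, pow_zero, one_mul, ← zpow_natCast]
      conv_rhs => rw [← zpow_one (y p m r)]
      apply y_zpow_congr
      simp
  exact DFunLike.congr_fun this g

theorem eq_x_pow_mul_y_pow (g : MetacyclicGroup p m r) :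
    g = x p m r ^ (toModel p m r g).e.val * y p m r ^ (toModel p m r g).b.val :=
  (ofModel_toModel p m r g).symm

/-- The coordinates of the presented group given by its normal form. -/
def coord (hu : ∀ i : ZMod p, i ≠ 0 → IsUnit ((r : ZMod m) ^ i.val - 1)) :
    FrobeniusCoord (MetacyclicGroup p m r) p m where
  e g := (toModel p m r g).e
  b g := (toModel p m r g).b
  ρ i := (r : ZMod m) ^ i.val
  e_mul g h := by rw [map_mul, MetacyclicModel.mul_e]
  b_mul g h := by rw [map_mul, MetacyclicModel.mul_b]
  ρ_zero := by rw [ZMod.val_zero, pow_zero]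
  ρ_add := ZMod.pow_val_add hr.out
  isUnit_ρ_sub_one := hu
  ext g h h1 h2 := by
    rw [← ofModel_toModel p m r g, ← ofModel_toModel p m r h, MetacyclicModel.ext h1 h2]
  exists_coord i j := ⟨x p m r ^ i.val * y p m r ^ j.val, by simp [toModel_x_pow_mul_y_pow]⟩

end MetacyclicGroup

/-! ### Fixed-point freeness, isomorphism type and the Davenport constant -/

theorem ZMod.isUnit_pow_sub_one {p m : ℕ} (hp : p.Prime) {r : ZMod m} (hr : r ^ p = 1)
    (h1 : IsUnit (r - 1)) {i : ℕ} (hi0 : i ≠ 0) (hip : i < p) : IsUnit (r ^ i - 1) := by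
  have hcop : Nat.Coprime i p :=
    ((Nat.Prime.coprime_iff_not_dvd hp).2
      fun h => hip.not_ge (Nat.le_of_dvd (Nat.pos_of_ne_zero hi0) h)).symm
  -- With ik ≡ 1 modulo p, the unit r − 1 = (r^i)^k − 1 is a multiple of r^i − 1.
  obtain ⟨k, -, hk⟩ := Nat.exists_mul_mod_eq_one_of_coprime hcop hp.one_lt
  have h2 : r ^ (i * k) = r := by rw [pow_eq_pow_mod _ hr, hk, pow_one]
  have h3 := sub_dvd_pow_sub_pow (r ^ i) 1 k
  rw [← pow_mul, h2, one_pow] at h3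
  exact isUnit_of_dvd_unit h3 h1

/-- A Frobenius group `C_p ⋉ C_m` is a semidirect product with nontrivial action. -/
theorem FrobeniusCoord.exists_mulEquiv_semidirectProduct {G : Type*} [Group G] {p m : ℕ}
    (c : FrobeniusCoord G p m) (hp : p ≠ 1) (hm : m ≠ 1) :
    ∃ φ : Multiplicative (ZMod p) →* MulAut (Multiplicative (ZMod m)), φ ≠ 1 ∧
      Nonempty (G ≃* SemidirectProduct (Multiplicative (ZMod m)) (Multiplicative (ZMod p)) φ) := by
  have hinv : ∀ i, c.ρ i * c.ρ (-i) = 1 := fun i => by rw [← c.ρ_add, add_neg_cancel, c.ρ_zero]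
  -- In `SemidirectProduct` the normal factor stands on the left: x^i y^j = (x^i y^j x^(−i)) x^i.
  -- This is why ρ is taken at −i.
  let act : Multiplicative (ZMod p) → MulAut (Multiplicative (ZMod m)) := fun a =>
    { toFun := fun n => Multiplicative.ofAdd (c.ρ (-a.toAdd) * n.toAdd)
      invFun := fun n => Multiplicative.ofAdd (c.ρ a.toAdd * n.toAdd)
      left_inv := fun n => by
        apply Multiplicative.toAdd.injective
        simp only [toAdd_ofAdd]
        linear_combination n.toAdd * hinv a.toAdd
      right_inv := fun n => by
        apply Multiplicative.toAdd.injective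
        simp only [toAdd_ofAdd]
        linear_combination n.toAdd * hinv a.toAdd
      map_mul' := fun n k => by
        apply Multiplicative.toAdd.injective
        simp only [toAdd_ofAdd, toAdd_mul]
        ring }
  have hact : ∀ a n, (act a n).toAdd = c.ρ (-a.toAdd) * n.toAdd := fun _ _ => rfl
  let φ : Multiplicative (ZMod p) →* MulAut (Multiplicative (ZMod m)) := MonoidHom.mk' act (by
    intro a b
    refine MulEquiv.ext fun n => Multiplicative.toAdd.injective ?_
    rw [MulAut.mul_apply, hact, hact, hact, toAdd_mul, neg_add, c.ρ_add]
    ring)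
  have hφ : ∀ a n, (φ a n).toAdd = c.ρ (-a.toAdd) * n.toAdd := hact
  have : Nontrivial (ZMod p) := ZMod.nontrivial_iff.2 hp
  have : Nontrivial (ZMod m) := ZMod.nontrivial_iff.2 hm
  refine ⟨φ, ?_, ?_⟩
  · intro h
    have h1 := hφ (Multiplicative.ofAdd (-1)) (Multiplicative.ofAdd 1)
    rw [h] at h1
    simp only [MonoidHom.one_apply, MulAut.one_apply, toAdd_ofAdd, neg_neg, mul_one] at h1
    have h2 := c.isUnit_ρ_sub_one 1 one_ne_zero
    rw [← h1, sub_self] at h2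
    exact not_isUnit_zero h2
  · let F : G →* SemidirectProduct (Multiplicative (ZMod m)) (Multiplicative (ZMod p)) φ :=
      MonoidHom.mk' (fun g => ⟨Multiplicative.ofAdd (c.ρ (-c.e g) * c.b g),
        Multiplicative.ofAdd (c.e g)⟩) (by
        intro g h
        refine SemidirectProduct.ext ?_ ?_
        · apply Multiplicative.toAdd.injective
          rw [SemidirectProduct.mul_left, toAdd_mul, hφ]
          simp only [toAdd_ofAdd, c.e_mul, c.b_mul, neg_add, c.ρ_add]
          linear_combination c.ρ (-c.e g) * c.b g * hinv (c.e h)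
        · apply Multiplicative.toAdd.injective
          rw [SemidirectProduct.mul_right, toAdd_mul]
          simp only [toAdd_ofAdd, c.e_mul])
    refine ⟨MulEquiv.ofBijective F ⟨fun g h hgh => ?_, fun z => ?_⟩⟩
    · have h1 : c.e g = c.e h := congrArg (fun z => z.right.toAdd) hgh
      have h2 : c.ρ (-c.e g) * c.b g = c.ρ (-c.e h) * c.b h :=
        congrArg (fun z => z.left.toAdd) hgh
      rw [h1] at h2
      exact c.ext _ _ h1 ((c.isUnit_ρ _).mul_right_injective h2)
    · obtain ⟨g, hg1, hg2⟩ := c.exists_coord z.right.toAdd (c.ρ z.right.toAdd * z.left.toAdd)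
      refine ⟨g, SemidirectProduct.ext ?_ ?_⟩
      · apply Multiplicative.toAdd.injective
        change c.ρ (-c.e g) * c.b g = _
        rw [hg1, hg2]
        linear_combination z.left.toAdd * hinv z.right.toAdd
      · apply Multiplicative.toAdd.injective
        exact hg1

theorem FrobeniusCoord.card_eq {G : Type*} [Group G] {p m : ℕ} (c : FrobeniusCoord G p m) :
    Nat.card G = p * m := by
  rw [Nat.card_congr (Equiv.ofBijective (fun g => (c.e g, c.b g)) ⟨fun g h hgh => ?_, fun z => ?_⟩),
    Nat.card_prod, Nat.card_zmod, Nat.card_zmod]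
  · exact c.ext _ _ (congrArg Prod.fst hgh) (congrArg Prod.snd hgh)
  · obtain ⟨g, h1, h2⟩ := c.exists_coord z.1 z.2
    exact ⟨g, Prod.ext h1 h2⟩

/-- The order pm = 6 alone would also allow p = 3; minimality of p excludes this. -/
theorem FrobeniusCoord.isIsoC2C3_iff {G : Type*} [Group G] {p m : ℕ} (c : FrobeniusCoord G p m)
    (hp : IsLeast {q : ℕ | q.Prime ∧ q ∣ Nat.card G} p) : IsIsoC2C3 G ↔ p = 2 ∧ m = 3 := by
  constructor
  · rintro ⟨φ, -, ⟨f⟩⟩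
    have h6 : Nat.card G = 6 := by
      rw [Nat.card_congr f.toEquiv, SemidirectProduct.card]
      simp
    have hp2 : p = 2 := le_antisymm (hp.2 ⟨Nat.prime_two, by rw [h6]; norm_num⟩) hp.1.1.two_le
    subst hp2
    rw [c.card_eq] at h6
    omega
  · rintro ⟨rfl, rfl⟩
    exact c.exists_mulEquiv_semidirectProduct (by norm_num) (by norm_num)

/-- The small Davenport constant of a Frobenius group `C_p ⋉ C_m`. -/
theorem FrobeniusCoord.smallDavenport_eq {G : Type*} [Group G] {p m : ℕ} [Fact p.Prime] [NeZero m]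
    (c : FrobeniusCoord G p m) : smallDavenport G = m + p - 2 := by
  have hp2 := (Fact.out : p.Prime).two_le
  have hm := NeZero.ne m
  -- The bound is attained by p − 1 copies of an element of class 1 and m − 1 copies of a generator
  -- of the kernel.
  obtain ⟨g, hg, -⟩ := c.exists_coord 1 0
  obtain ⟨h, hh, hb⟩ := c.exists_coord 0 1
  refine IsGreatest.csSup_eq ⟨⟨Multiset.replicate (p - 1) g + Multiset.replicate (m - 1) h, ?_,
    c.productOneFree_of_eq (g := 1) one_ne_zero ?_ ?_ hh ?_ (by omega)⟩, ?_⟩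
  · rw [Multiset.card_add, Multiset.card_replicate, Multiset.card_replicate]
    omega
  · rw [Multiset.card_replicate]
    omega
  · intro s hs
    rw [Multiset.eq_of_mem_replicate hs, hg]
  · rw [hb]
    exact isUnit_one
  · rintro l ⟨S, rfl, hS⟩
    have := c.card_le_of_productOneFree hS
    omega

/-! ### Translation into powers of x and y, and the theorem -/

namespace MetacyclicGroup

theorem exists_multiset_eq {p m : ℕ} {r : ℤ} [Fact p.Prime] [NeZero m]
    [Fact ((r : ZMod m) ^ p = 1)] (R : Multiset (MetacyclicGroup p m r)) {g : ZMod p}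
    (hR : ∀ s ∈ R, (toModel p m r s).e = g) {n : ℕ} (hn : R.card = n) :
    ∃ b : Fin n → ℕ, (∀ i, b i ≤ m - 1) ∧
      R = (Finset.univ : Finset (Fin n)).val.map fun i => x p m r ^ g.val * y p m r ^ b i := by
  subst hn
  have hlen : R.toList.length = R.card := Multiset.length_toList R
  let f : Fin R.card → MetacyclicGroup p m r := fun i => R.toList.get (i.cast hlen.symm)
  refine ⟨fun i => (toModel p m r (f i)).b.val, fun i => Nat.le_sub_one_of_lt (ZMod.val_lt _), ?_⟩
  have hf : ∀ i, x p m r ^ g.val * y p m r ^ (toModel p m r (f i)).b.val = f i := by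
    intro i
    rw [← hR (f i) (Multiset.mem_toList.1 (List.get_mem _ _)), ← eq_x_pow_mul_y_pow]
  simp only [hf]
  have h1 : (Finset.univ : Finset (Fin R.card)).val.map f = (List.ofFn f : List _) := by
    rw [Fin.univ_val_map]
  have h2 : List.ofFn f = R.toList := by
    refine List.ext_getElem (by simp) fun i _ _ => ?_
    simp [f]
  rw [h1, h2, Multiset.coe_toList]

end MetacyclicGroup

open MetacyclicGroup

theorem theorem1p1 (p m : ℕ) (r : ℤ)
    (hr : r ^ p ≡ 1 [ZMOD (m : ℤ)])
    (hp : IsLeast {q : ℕ | q.Prime ∧ q ∣ Nat.card (MetacyclicGroup p m r)} p)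
    (hgcd : Int.gcd ((p : ℤ) * (r - 1)) (m : ℤ) = 1) :
    smallDavenport (MetacyclicGroup p m r) = m + p - 2 ∧
    ∀ S : Multiset (MetacyclicGroup p m r),
      S.card = smallDavenport (MetacyclicGroup p m r) →
      (ProductOneFree S ↔
        (¬ IsIsoC2C3 (MetacyclicGroup p m r) →
          ∃ (a : ℕ) (b : Fin (p - 1) → ℕ) (c : ℕ),
            1 ≤ a ∧ a ≤ p - 1 ∧ (∀ i, b i ≤ m - 1) ∧ c ≤ m - 1 ∧ Nat.gcd c m = 1 ∧
            S = (Finset.univ : Finset (Fin (p - 1))).val.map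
                  (fun i => MetacyclicGroup.x p m r ^ a * MetacyclicGroup.y p m r ^ b i)
                + Multiset.replicate (m - 1) (MetacyclicGroup.y p m r ^ c)) ∧
        (IsIsoC2C3 (MetacyclicGroup p m r) →
          S = {MetacyclicGroup.x p m r,
               MetacyclicGroup.x p m r * MetacyclicGroup.y p m r,
               MetacyclicGroup.x p m r * MetacyclicGroup.y p m r ^ 2} ∨
          ∃ b c : ℕ, b ≤ 2 ∧ 1 ≤ c ∧ c ≤ 2 ∧
            S = {MetacyclicGroup.x p m r * MetacyclicGroup.y p m r ^ b}
                + Multiset.replicate 2 (MetacyclicGroup.y p m r ^ c))) := by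
  have hpp : p.Prime := hp.1.1
  have hp2 := hpp.two_le
  -- For m = 0 the gcd would be |p(r − 1)|, a multiple of p.
  have hm0 : m ≠ 0 := by
    rintro rfl
    rw [Nat.cast_zero, Int.gcd_zero_right, Int.natAbs_mul, Int.natAbs_natCast] at hgcd
    exact hpp.one_lt.ne' (Nat.eq_one_of_mul_eq_one_right hgcd)
  have : NeZero m := ⟨hm0⟩
  have : Fact p.Prime := ⟨hpp⟩
  have hr' : (r : ZMod m) ^ p = 1 := by
    have := (ZMod.intCast_eq_intCast_iff _ _ _).2 hr
    simpa using this
  have : Fact ((r : ZMod m) ^ p = 1) := ⟨hr'⟩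
  have hcopZ : IsCoprime ((p : ℤ) * (r - 1)) (m : ℤ) := Int.isCoprime_iff_gcd_eq_one.2 hgcd
  have hcop : p.Coprime m :=
    Nat.isCoprime_iff_coprime.1 (IsCoprime.of_mul_left_left hcopZ)
  have hr1 : IsUnit ((r : ZMod m) - 1) := by
    obtain ⟨u, v, huv⟩ := IsCoprime.of_mul_left_right hcopZ
    have h1 := congrArg (Int.cast : ℤ → ZMod m) huv
    push_cast at h1
    rw [CharP.cast_eq_zero, mul_zero, add_zero, mul_comm] at h1
    exact IsUnit.of_mul_eq_one _ h1
  let c := coord p m r fun i hi => ZMod.isUnit_pow_sub_one hpp hr' hr1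
    (fun h => hi ((ZMod.val_eq_zero i).1 h)) (ZMod.val_lt i)
  have hce : ∀ i j : ℕ, c.e (x p m r ^ i * y p m r ^ j) = i := fun i j =>
    congrArg MetacyclicModel.e (toModel_x_pow_mul_y_pow p m r i j)
  have hcb : ∀ i j : ℕ, c.b (x p m r ^ i * y p m r ^ j) = j := fun i j =>
    congrArg MetacyclicModel.b (toModel_x_pow_mul_y_pow p m r i j)
  have hnf : ∀ g, g = x p m r ^ (c.e g).val * y p m r ^ (c.b g).val := eq_x_pow_mul_y_pow p m r
  have hye : ∀ j : ℕ, c.e (y p m r ^ j) = 0 := fun j => by simpa using hce 0 j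
  have hyb : ∀ j : ℕ, c.b (y p m r ^ j) = j := fun j => by simpa using hcb 0 j
  have hd := c.smallDavenport_eq
  have hiso := c.isIsoC2C3_iff hp
  refine ⟨hd, fun S hS => ?_⟩
  rw [hd] at hS
  rw [hiso]
  constructor
  · intro hf
    rcases c.eq_of_productOneFree hcop hf (by omega) with
      ⟨g, hg, R, h, hRc, hRe, hh, hb, rfl⟩ | ⟨rfl, rfl, hnd, he⟩
    · have hhy : h = y p m r ^ (c.b h).val := by
        have := hnf h
        rwa [hh, ZMod.val_zero, pow_zero, one_mul] at this
      have hg1 : 1 ≤ g.val := Nat.one_le_iff_ne_zero.2 fun h => hg ((ZMod.val_eq_zero g).1 h)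
      constructor
      · intro _
        obtain ⟨b, hbm, hRb⟩ := exists_multiset_eq R hRe hRc
        refine ⟨g.val, b, (c.b h).val, hg1, Nat.le_sub_one_of_lt (ZMod.val_lt g), hbm,
          Nat.le_sub_one_of_lt (ZMod.val_lt _), ?_, ?_⟩
        · rw [← Nat.coprime_iff_gcd_eq_one, ← ZMod.isUnit_iff_coprime]
          simpa using hb
        · rw [← hhy, ← hRb]
      -- For p = 2 and m = 3 the generic form has a single term outside the kernel, which is the
      -- second form in the exceptional case.
      · rintro ⟨rfl, rfl⟩
        right
        obtain ⟨s, rfl⟩ := Multiset.card_eq_one.1 hRc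
        have hs : c.e s = 1 := by
          rw [hRe s (by simp)]
          exact ZMod.eq_one_of_ne_zero_of_two hg
        refine ⟨(c.b s).val, (c.b h).val, Nat.le_of_lt_succ (ZMod.val_lt _), ?_,
          Nat.le_of_lt_succ (ZMod.val_lt _), ?_⟩
        · exact Nat.one_le_iff_ne_zero.2 fun h0 => hb.ne_zero ((ZMod.val_eq_zero _).1 h0)
        · have hs' := hnf s
          rw [hs, ZMod.val_one, pow_one] at hs'
          rw [← hs', ← hhy]
    · refine ⟨fun h => absurd ⟨rfl, rfl⟩ h, fun _ => Or.inl ?_⟩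
      -- Only x, xy and xy² have class 1, and `S` consists of three distinct elements of that class.
      refine Multiset.eq_of_le_of_card_le ((Multiset.le_iff_subset hnd).2 fun s hs => ?_) ?_
      · have hs' := hnf s
        rw [he s hs, ZMod.val_one, pow_one] at hs'
        have hlt := ZMod.val_lt (c.b s)
        rw [hs']
        generalize (c.b s).val = k at hlt ⊢
        interval_cases k <;> simp
      · simp [hS]
  · rintro ⟨h1, h2⟩
    by_cases hpm : p = 2 ∧ m = 3
    · obtain ⟨rfl, rfl⟩ := hpm
      rcases h2 ⟨rfl, rfl⟩ with rfl | ⟨b, k, hb, hk1, hk2, rfl⟩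
      · have e0 := hce 1 0
        have e1 := hce 1 1
        have e2 := hce 1 2
        have b0 := hcb 1 0
        have b1 := hcb 1 1
        have b2 := hcb 1 2
        simp only [pow_zero, pow_one, mul_one, Nat.cast_zero, Nat.cast_one, Nat.cast_ofNat]
          at e0 e1 e2 b0 b1 b2
        refine c.productOneFree_of_nodup ?_ (by simp) ?_
        · have hne : ∀ u v, c.b u ≠ c.b v → u ≠ v := fun u v h huv => h (congrArg c.b huv)
          simp only [Multiset.insert_eq_cons, Multiset.nodup_cons, Multiset.mem_cons,
            Multiset.mem_singleton, not_or, Multiset.nodup_singleton, and_true]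
          refine ⟨⟨hne _ _ ?_, hne _ _ ?_⟩, hne _ _ ?_⟩
          · rw [b0, b1]; decide
          · rw [b0, b2]; decide
          · rw [b1, b2]; decide
        · intro s hs
          simp only [Multiset.insert_eq_cons, Multiset.mem_cons, Multiset.mem_singleton] at hs
          rcases hs with rfl | rfl | rfl
          · exact e0
          · exact e1
          · exact e2
      · refine c.productOneFree_of_eq (g := 1) one_ne_zero (by simp) ?_ (hye k) ?_ (by norm_num)
        · intro s hs
          rw [Multiset.mem_singleton.1 hs]
          simpa using hce 1 b
        · rw [hyb, ZMod.isUnit_iff_coprime]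
          interval_cases k <;> decide
    · obtain ⟨a, b, k, ha1, hap, -, -, hk, rfl⟩ := h1 hpm
      clear h1 h2
      refine c.productOneFree_of_eq (g := (a : ZMod p)) ?_ ?_ ?_ (hye k) ?_ (by omega)
      · rw [Ne, ZMod.natCast_eq_zero_iff]
        exact fun h => absurd (Nat.le_of_dvd (by omega) h) (by omega)
      · simp
        omega
      · intro s hs
        obtain ⟨i, -, rfl⟩ := Multiset.mem_map.1 hs
        exact hce a (b i)
      · rw [hyb, ZMod.isUnit_iff_coprime]
        exact hk
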